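/- Let $V$ be an $N$-dimensional complex vector space with basis $e_1,\dots,e_N$. Let $\mathcal A\subset V^*\setminus\{0\}$ be a finite set of covectors contained in a lattice of rank $N$ (the $\mathbb Z$-span of a basis of $V^*$), and let $c\colon\mathcal A\to\mathbb C$, $\alpha\mapsto c_\alpha$, be such that the bilinear form $G_{\mathcal A}(u,v)=\sum_{\alpha\in\mathcal A}c_\alpha\alpha(u)\alpha(v)$ on $V$ is non-degenerate. Write $\alpha^\vee\in V$ for the vector with $G_{\mathcal A}(\alpha^\vee,v)=\alpha(v)$ for all $v\in V$. Let $\lambda\in\mathbb C\setminus\{0\}$. **WDVV.** Put $f(z)=\frac{i}{6}z^3+\frac14\mathrm{Li}_3(e^{-2iz})$, where $\mathrm{Li}_3$ is the principal branch on $\mathbb C\setminus[1,\infty)$ (so $f'''(z)=\cot z$), and $$F(x,y)=\tfrac13y^3+\sum_{\alpha\in\mathcal A}c_\alpha\alpha(x)^2\,y+\lambda\sum_{\alpha\in\mathcal A}c_\alpha f(\alpha(x)),\qquad (x,y)\in V\oplus\mathbb C .$$ Let $x_1,\dots,x_N$ be the coordinates of $x$ in the basis $e_1,\dots,e_N$,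 let $x_{N+1}=y$, and let $F_i$ be the $(N+1)\times(N+1)$ matrix with entries $(F_i)_{pq}=\frac{\partial^3F}{\partial x_i\partial x_p\partial x_q}$. The WDVV equations for $F$ are $$F_iF_{N+1}^{-1}F_j=F_jF_{N+1}^{-1}F_i,\qquad i,j=1,\dots,N,$$ at all points of the open dense set of those $(x,y)$ with $e^{-2i\alpha(x)}\notin[1,\infty)$ for all $\alpha\in\mathcal A$. **Trigonometric $\vee$-systems.** For $\alpha\in\mathcal A$ let $\delta_\alpha$ be the set of elements of $\mathcal A$ collinear with $\alpha$. On $\mathcal A\setminus\delta_\alpha$ consider the equivalence relation: $\beta\sim\gamma$ if $\beta+\gamma\in\mathbb Z\alpha$ or $\beta-\gamma\in\mathbb Z\alpha$. Its classes are the $\alpha$-series. With $\alpha\wedge\beta=\alpha\otimes\beta-\beta\otimes\alpha$, the pair $(\mathcal A,c)$ is a trigonometric $\vee$-system if for every $\alpha\in\mathcal A$ and every $\alpha$-series $\Gamma$ $$\sum_{\beta\in\Gamma}c_\beta\,\alpha(\beta^\vee)\,\alpha\wedge\beta=0 .$$ **Forms on $\Lambda^2V\subset V\otimes V$.** Let $B_{\alpha,\beta}(a\otimes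 b)=\alpha(a)\beta(b)-\alpha(b)\beta(a)$ and $$G^{(1)}_{\mathcal A}(z,w)=\sum_{\alpha,\beta\in\mathcal A}c_\alpha c_\beta B_{\alpha,\beta}(z)B_{\alpha,\beta}(w),\qquad G^{(2)}_{\mathcal A_+}(z,w)=\sum_{\alpha,\beta\in\mathcal A_+}c_\alpha c_\beta\, G_{\mathcal A}(\alpha^\vee,\beta^\vee)B_{\alpha,\beta}(z)B_{\alpha,\beta}(w)$$ for $z,w\in\Lambda^2V$. Here a positive system $\mathcal A_+$ is obtained by choosing $v\in V$ with $\mathrm{Re}\,\alpha(v)\ne0$ for all $\alpha\in\mathcal A$, replacing each $\alpha\in\mathcal A$ with $\mathrm{Re}\,\alpha(v)<0$ by $-\alpha$ with the same multiplicity, and merging repeated covectors by adding up their multiplicities. **Theorem.** (a) Suppose that for all $\alpha\in\mathcal A$, all non-empty $\delta\subset\delta_\alpha$ and all $\alpha_0\in\delta_\alpha$ one has $C_\delta^{\alpha_0}:=\sum_{\gamma\in\delta}c_\gamma k_\gamma^2\neq0$, where $\gamma=k_\gamma\alpha_0$. If the WDVV equations for $F$ hold, then 1. $(\mathcal A,c)$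 is a trigonometric $\vee$-system, and 2. $G^{(1)}_{\mathcal A}=\frac{\lambda^2}{4}G^{(2)}_{\mathcal A_+}$ on $\Lambda^2V$ for every positive system $\mathcal A_+$. (b) Conversely (without the assumption on $C_\delta^{\alpha_0}$), if $(\mathcal A,c)$ is a trigonometric $\vee$-system and $G^{(1)}_{\mathcal A}=\frac{\lambda^2}{4}G^{(2)}_{\mathcal A_+}$ for some positive system $\mathcal A_+$, then the WDVV equations for $F$ hold. -/

import Mathlib

open scoped TensorProduct

noncomputable section

namespace TrigVee

variable {V : Type*} [AddCommGroup V] [Module ℂ V]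

/-- The finite set `A` of covectors is contained in a lattice of rank `dim V` in `V*`, that is, in
the `ℤ`-span of some basis of `V*`. -/
def InLattice (A : Finset (Module.Dual ℂ V)) : Prop :=
  ∃ e : Module.Basis (Fin (Module.finrank ℂ V)) ℂ (Module.Dual ℂ V),
    ∀ α ∈ A, α ∈ Submodule.span ℤ (Set.range e)

/-- The bilinear form `G_A(u, v) = ∑_{α ∈ A} c_α α(u) α(v)` on `V`. -/
def formG (A : Finset (Module.Dual ℂ V)) (c : Module.Dual ℂ V → ℂ) : LinearMap.BilinForm ℂ V :=
  ∑ α ∈ A, c α • LinearMap.BilinForm.linMulLin α α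

/-- The vector `α^∨ ∈ V` with `G_A(α^∨, v) = α(v)` for all `v`. -/
def vee [FiniteDimensional ℂ V] {A : Finset (Module.Dual ℂ V)} {c : Module.Dual ℂ V → ℂ}
    (hG : (formG A c).Nondegenerate) (α : Module.Dual ℂ V) : V :=
  ((formG A c).toDual hG).symm α

open Classical in
/-- `δ_α`: the covectors of `A` collinear with `α`. -/
def collinearSet (A : Finset (Module.Dual ℂ V)) (α : Module.Dual ℂ V) :
    Finset (Module.Dual ℂ V) :=
  A.filter fun γ => ∃ k : ℂ, γ = k • α

/-- The number `k_γ` with `γ = k_γ α₀`, for `γ` collinear with `α₀ ≠ 0`. (It is automatically real,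
even rational, when both covectors belong to a lattice of rank `dim V` in `V*`.) -/
def collinearCoeff (α₀ γ : Module.Dual ℂ V) : ℂ :=
  Classical.epsilon fun k : ℂ => γ = k • α₀

/-- `C_δ^{α₀} = ∑_{γ ∈ δ} c_γ k_γ²`, where `γ = k_γ α₀`. -/
def collinearSum (c : Module.Dual ℂ V → ℂ) (δ : Finset (Module.Dual ℂ V))
    (α₀ : Module.Dual ℂ V) : ℂ :=
  ∑ γ ∈ δ, c γ * collinearCoeff α₀ γ ^ 2

/-- `Γ` is an `α`-series in `A`: a non-empty set of covectors of `A` not collinear with `α`, any two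
of which have their sum or their difference in `ℤ α`, and which contains every covector of `A` of
the form `± γ + m α` with `γ ∈ Γ` and `m ∈ ℤ`. -/
structure IsSeries (A : Finset (Module.Dual ℂ V)) (α : Module.Dual ℂ V)
    (Γ : Finset (Module.Dual ℂ V)) : Prop where
  subset : Γ ⊆ A
  not_collinear : ∀ γ ∈ Γ, γ ∉ collinearSet A α
  nonempty : Γ.Nonempty
  related : ∀ γ₁ ∈ Γ, ∀ γ₂ ∈ Γ, ∃ m : ℤ, γ₁ + γ₂ = m • α ∨ γ₁ - γ₂ = m • α
  maximal : ∀ γ ∈ Γ, ∀ β ∈ A, ∀ m : ℤ, (β = γ + m • α ∨ β = -γ + m • α) → β ∈ Γ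

/-- `u ∧ v = u ⊗ v - v ⊗ u`. -/
def wedge {M : Type*} [AddCommGroup M] [Module ℂ M] (u v : M) : M ⊗[ℂ] M :=
  u ⊗ₜ[ℂ] v - v ⊗ₜ[ℂ] u

/-- `(A, c)` is a trigonometric `∨`-system: for all `α ∈ A` and every `α`-series `Γ`,
`∑_{β ∈ Γ} c_β α(β^∨) α ∧ β = 0`. -/
def IsTrigVeeSystem [FiniteDimensional ℂ V] {A : Finset (Module.Dual ℂ V)}
    {c : Module.Dual ℂ V → ℂ} (hG : (formG A c).Nondegenerate) : Prop :=
  ∀ α ∈ A, ∀ Γ : Finset (Module.Dual ℂ V), IsSeries A α Γ →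
    ∑ β ∈ Γ, (c β * α (vee hG β)) • wedge α β = 0

variable (V) in
/-- `Λ²V` as a subspace of `V ⊗ V`. -/
def altSquare : Submodule ℂ (V ⊗[ℂ] V) :=
  Submodule.span ℂ (Set.range fun p : V × V => wedge p.1 p.2)

/-- `B_{α,β} = α ∧ β` as a functional on `V ⊗ V`: `B_{α,β}(a ⊗ b) = α(a) β(b) - α(b) β(a)`. -/
def formB (α β : Module.Dual ℂ V) : Module.Dual ℂ (V ⊗[ℂ] V) :=
  TensorProduct.dualDistrib ℂ V V (wedge α β)

/-- The bilinear form `G_A^{(1)}` on `Λ²V`. -/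
def formG1 (A : Finset (Module.Dual ℂ V)) (c : Module.Dual ℂ V → ℂ) :
    LinearMap.BilinForm ℂ (altSquare V) :=
  LinearMap.BilinForm.restrict
    (∑ α ∈ A, ∑ β ∈ A, (c α * c β) • LinearMap.BilinForm.linMulLin (formB α β) (formB α β))
    (altSquare V)

/-- `v` lies on no hyperplane `Re α = 0` with `α ∈ A`. Such a vector defines the open half-space
`{ξ ∈ V* | Re ξ(v) > 0}`, which contains exactly one of `α`, `-α` for every `α ∈ A`. -/
def IsRegular (A : Finset (Module.Dual ℂ V)) (v : V) : Prop :=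
  ∀ α ∈ A, (α v).re ≠ 0

open Classical in
/-- The one of `α`, `-α` that lies in the half-space `Re ξ(v) > 0`. -/
def makePos (v : V) (α : Module.Dual ℂ V) : Module.Dual ℂ V :=
  if 0 < (α v).re then α else -α

open Classical in
/-- The positive system `A₊` in the half-space given by `v`: covectors outside of the half-space
are replaced with their opposites. -/
def posSystem (A : Finset (Module.Dual ℂ V)) (v : V) : Finset (Module.Dual ℂ V) :=
  A.image (makePos v)

open Classical in
/-- The multiplicities of `A₊`: multiplicities of repeated covectors are added up. -/
def posMult (A : Finset (Module.Dual ℂ V)) (c : Module.Dual ℂ V → ℂ) (v : V)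
    (β : Module.Dual ℂ V) : ℂ :=
  ∑ α ∈ A with makePos v α = β, c α

/-- The bilinear form `G_{A₊}^{(2)}` on `Λ²V`, for the positive system `A₊` given by `v`. -/
def formG2 [FiniteDimensional ℂ V] {A : Finset (Module.Dual ℂ V)} {c : Module.Dual ℂ V → ℂ}
    (hG : (formG A c).Nondegenerate) (v : V) : LinearMap.BilinForm ℂ (altSquare V) :=
  LinearMap.BilinForm.restrict
    (∑ α ∈ posSystem A v, ∑ β ∈ posSystem A v,
      (posMult A c v α * posMult A c v β * formG A c (vee hG α) (vee hG β)) •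
        LinearMap.BilinForm.linMulLin (formB α β) (formB α β))
    (altSquare V)

/-- The principal branch of the trilogarithm on `ℂ ∖ [1, ∞)`, as the integral
`Li₃(w) = (1/2) ∫₀¹ w log²(s) / (1 - w s) ds`. It is the analytic continuation of
`∑_{n ≥ 1} wⁿ / n³`, since `∫₀¹ sⁿ⁻¹ log²(s) ds = 2 / n³`. -/
def trilog (w : ℂ) : ℂ :=
  (1 / 2) * ∫ s in (0 : ℝ)..1, w * (Real.log s : ℂ) ^ 2 / (1 - w * s)

/-- `f(z) = (i/6) z³ + (1/4) Li₃(e^{-2iz})`, so that `f'''(z) = cot z`. -/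
def trigF (z : ℂ) : ℂ :=
  Complex.I / 6 * z ^ 3 + 1 / 4 * trilog (Complex.exp (-2 * Complex.I * z))

/-- The function `F = y³/3 + ∑ c_α α(x)² y + λ ∑ c_α f(α(x))` on `V ⊕ ℂ`. -/
def prepotential (A : Finset (Module.Dual ℂ V)) (c : Module.Dual ℂ V → ℂ) (lam : ℂ)
    (p : V × ℂ) : ℂ :=
  1 / 3 * p.2 ^ 3 + (∑ α ∈ A, c α * α p.1 ^ 2) * p.2 + lam * ∑ α ∈ A, c α * trigF (α p.1)

/-- The open dense subset of `V ⊕ ℂ` on which the principal branches in `F` are holomorphic: no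
`e^{-2iα(x)}` with `α ∈ A` lies on the cut `[1, ∞)`. -/
def holDomain (A : Finset (Module.Dual ℂ V)) : Set (V × ℂ) :=
  {p | ∀ α ∈ A, 1 - Complex.exp (-2 * Complex.I * α p.1) ∈ Complex.slitPlane}

/-- The basis vectors `e_1, …, e_N, e_{N+1}` of `V ⊕ ℂ`; the last one has the index `inr ()`. -/
def extBasis {N : ℕ} (b : Module.Basis (Fin N) ℂ V) : Fin N ⊕ Unit → V × ℂ :=
  Sum.elim (fun i => (b i, 0)) fun _ => (0, 1)

/-- The matrix `F_i` of third partial derivatives `∂³F / ∂x_i ∂x_p ∂x_q` at the point `P`. -/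
def thirdMatrix {N : ℕ} (b : Module.Basis (Fin N) ℂ V) (F : V × ℂ → ℂ) (P : V × ℂ)
    (i : Fin N ⊕ Unit) : Matrix (Fin N ⊕ Unit) (Fin N ⊕ Unit) ℂ :=
  Matrix.of fun p q =>
    lineDeriv ℂ (fun P₁ => lineDeriv ℂ (fun P₂ => lineDeriv ℂ F P₂ (extBasis b q)) P₁
      (extBasis b p)) P (extBasis b i)

/-- The WDVV equations `F_i F_{N+1}⁻¹ F_j = F_j F_{N+1}⁻¹ F_i`, `i, j = 1, …, N`, on a set. -/
def WDVVOn {N : ℕ} (b : Module.Basis (Fin N) ℂ V) (F : V × ℂ → ℂ) (D : Set (V × ℂ)) : Prop :=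
  ∀ P ∈ D, ∀ i j : Fin N,
    thirdMatrix b F P (Sum.inl i) * (thirdMatrix b F P (Sum.inr ()))⁻¹ *
        thirdMatrix b F P (Sum.inl j) =
      thirdMatrix b F P (Sum.inl j) * (thirdMatrix b F P (Sum.inr ()))⁻¹ *
        thirdMatrix b F P (Sum.inl i)

end TrigVee

end

open scoped TensorProduct

noncomputable section

namespace TrigVee

open Filter Topology Set MeasureTheory

/-! The third derivatives of `F` depend on `x` alone and `F_{N+1}` is block diagonal with blocks
`2G` and `2`. The WDVV equations therefore reduce to one identity of forms on `Λ²V`: `G⁽¹⁾ + (λ²/4)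
∑ c_α c_β G(α^∨, β^∨) cot α(x) cot β(x) B_{α,β} ⊗ B_{α,β} = 0` (`wdvvOn_iff`, `wdvvOn_iff_cotPair`).
The question is when this cotangent sum is constant in `x`, and with which value.

The value is read off at infinity: along `i t v` each `cot α` tends to `-i` times the sign of `Re
α(v)`, so the sum tends to `-G⁽²⁾` (`formG2_apply`, `formG1_eq_of_wdvv`). This gives (a.2).

For (b), the lattice provides lines on which all covectors of `A` have non-zero integer slopes
(`exists_int_values`). On a generic such line the sum has period `π`, at most simple poles and
limits at `± i∞`. The `∨`-conditions make its residues vanish (`sum_veeKernel_mul_cot`), so by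
Liouville it is constant and equals its limit (`cotSum_eq_of_residues`,
`cotPair_eq_of_isTrigVeeSystem`).

For (a.1), the residue at `α(x) ∈ πℤ` must vanish. It carries a factor `C_δ^α`; dividing by it
leaves a linear relation between the `cot β(x)` on these hyperplanes (`sum_cot_eq_zero_of_wdvv`). To
split the relation into `α`-series, let `x` tend to infinity in an imaginary direction inside `ker
α`: the most slowly decaying exponentials cancel among themselves. At the points `kπa` with `α(a) =
1` they become power sums, and a Vandermonde argument separates the classes modulo `ℤα`. Induction
on the remaining covectors finishes (`sum_series_eq_zero_of_cot`). -/

/-! ### The trilogarithm integral and the identity `f''' = cot`. -/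

lemma one_sub_mul_mem_slitPlane {w : ℂ} (hw : 1 - w ∈ Complex.slitPlane) {s : ℝ} (h0 : 0 ≤ s)
    (h1 : s ≤ 1) : 1 - w * s ∈ Complex.slitPlane := by
  have := StarConvex.add_smul_mem Complex.starConvex_one_slitPlane (y := -w)
    (by simpa [sub_eq_add_neg] using hw) h0 h1
  convert this using 1
  rw [Complex.real_smul]; ring

lemma one_sub_mul_ne_zero {w : ℂ} (hw : 1 - w ∈ Complex.slitPlane) {s : ℝ}
    (hs : s ∈ Icc (0 : ℝ) 1) : 1 - w * s ≠ 0 :=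
  Complex.slitPlane_ne_zero (one_sub_mul_mem_slitPlane hw hs.1 hs.2)

lemma isOpen_one_sub_slitPlane : IsOpen {w : ℂ | 1 - w ∈ Complex.slitPlane} :=
  Complex.isOpen_slitPlane.preimage (by fun_prop)

lemma intervalIntegrable_div_one_sub_mul_pow {g : ℝ → ℂ} (hg : IntervalIntegrable g volume 0 1)
    {w : ℂ} (hw : 1 - w ∈ Complex.slitPlane) (n : ℕ) :
    IntervalIntegrable (fun s : ℝ => g s / (1 - w * s) ^ n) volume 0 1 := by
  simp_rw [div_eq_mul_inv]
  refine hg.mul_continuousOn ?_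
  rw [uIcc_of_le zero_le_one]
  exact ContinuousOn.inv₀ (by fun_prop) fun s hs => pow_ne_zero _ (one_sub_mul_ne_zero hw hs)

/-- Differentiation under the integral sign: `(1 - z s)⁻²` is bounded on the compact product of a
small closed ball around `w` and `[0, 1]`, so a multiple of `‖g‖` dominates. It is applied to `g =
log²` and `g = log`. -/
lemma hasDerivAt_integral_mul_div {g : ℝ → ℂ} (hg : IntervalIntegrable g volume 0 1)
    {w : ℂ} (hw : 1 - w ∈ Complex.slitPlane) :
    HasDerivAt (fun w : ℂ => ∫ s in (0 : ℝ)..1, w * g s / (1 - w * s))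
      (∫ s in (0 : ℝ)..1, g s / (1 - w * s) ^ 2) w := by
  obtain ⟨ε, hε, hball⟩ := Metric.nhds_basis_closedBall.mem_iff.1
    (isOpen_one_sub_slitPlane.mem_nhds hw)
  have hcont : ContinuousOn (fun p : ℂ × ℝ => ‖((1 - p.1 * p.2) ^ 2)⁻¹‖)
      (Metric.closedBall w ε ×ˢ Icc (0 : ℝ) 1) := by
    refine (ContinuousOn.inv₀ (by fun_prop) ?_).norm
    rintro ⟨z, s⟩ ⟨hz, hs⟩
    exact pow_ne_zero _ (one_sub_mul_ne_zero (hball hz) hs)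
  obtain ⟨C, hC⟩ := (((isCompact_closedBall w ε).prod isCompact_Icc).image_of_continuousOn
    hcont).bddAbove
  have hint : ∀ z ∈ Metric.closedBall w ε,
      IntervalIntegrable (fun s : ℝ => z * g s / (1 - z * s)) volume 0 1 := by
    intro z hz
    simpa using intervalIntegrable_div_one_sub_mul_pow (hg.const_mul z) (hball hz) 1
  refine (intervalIntegral.hasDerivAt_integral_of_dominated_loc_of_deriv_le
    (F := fun (w : ℂ) (s : ℝ) => w * g s / (1 - w * s))
    (F' := fun (w : ℂ) (s : ℝ) => g s / (1 - w * s) ^ 2) (bound := fun s => C * ‖g s‖)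
    (Metric.closedBall_mem_nhds w hε) ?_ (hint w (Metric.mem_closedBall_self hε.le)) ?_ ?_
    (hg.norm.const_mul C) ?_).2
  · filter_upwards [Metric.closedBall_mem_nhds w hε] with z hz
    exact (intervalIntegrable_iff.1 (hint z hz)).aestronglyMeasurable
  · exact (intervalIntegrable_iff.1
      (intervalIntegrable_div_one_sub_mul_pow hg hw 2)).aestronglyMeasurable
  · refine Eventually.of_forall fun s hs z hz => ?_
    rw [uIoc_of_le zero_le_one] at hs
    rw [div_eq_mul_inv, norm_mul, mul_comm]
    gcongr
    exact hC ⟨(z, s), ⟨hz, hs.1.le, hs.2⟩, rfl⟩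
  · refine Eventually.of_forall fun s hs z hz => ?_
    rw [uIoc_of_le zero_le_one] at hs
    have hne : 1 - z * s ≠ 0 := one_sub_mul_ne_zero (hball hz) ⟨hs.1.le, hs.2⟩
    have h1 : HasDerivAt (fun z : ℂ => z * g s) (g s) z := by
      simpa using (hasDerivAt_id z).mul_const (g s)
    have h2 : HasDerivAt (fun z : ℂ => 1 - z * s) (-s) z := by
      simpa using ((hasDerivAt_id z).mul_const (s : ℂ)).const_sub 1
    refine (h1.fun_div h2 hne).congr_deriv ?_
    congr 1
    ring

lemma continuousOn_mul_log_sq : ContinuousOn (fun s : ℝ => s * Real.log s ^ 2) (Icc 0 1) := by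
  -- For `s ≥ 0`, `s log² s = 4 (√s log √s)²`, which reduces the claim to the continuity of `s log
  -- s`.
  have h : Continuous fun s : ℝ => 4 * (√s * Real.log √s) ^ 2 :=
    ((Real.continuous_mul_log.comp Real.continuous_sqrt).pow 2).const_mul 4 |>.congr fun s => by simp
  refine h.continuousOn.congr fun s hs => ?_
  simp only
  rw [Real.log_sqrt hs.1, mul_pow, Real.sq_sqrt hs.1]
  ring

lemma intervalIntegrable_log_sq : IntervalIntegrable (fun s : ℝ => Real.log s ^ 2) volume 0 1 := by
  rw [intervalIntegrable_iff_integrableOn_Ioc_of_le zero_le_one]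
  -- A primitive of `log²` that is continuous on `[0, 1]`; since `log² ≥ 0`, this suffices for
  -- integrability.
  refine intervalIntegral.integrableOn_deriv_of_nonneg
    (g := fun s => s * Real.log s ^ 2 - 2 * (s * Real.log s) + 2 * s) ?_ ?_ ?_
  · exact (continuousOn_mul_log_sq.sub (Real.continuous_mul_log.continuousOn.const_mul 2)).add
      (by fun_prop)
  · intro s hs
    have hl := Real.hasDerivAt_log hs.1.ne'
    refine ((((hasDerivAt_id' s).fun_mul (hl.fun_pow 2)).fun_sub
      (((hasDerivAt_id' s).fun_mul hl).const_mul 2)).fun_add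
        ((hasDerivAt_id' s).const_mul 2)).congr_deriv ?_
    have := hs.1.ne'
    push_cast
    field_simp
    ring
  · intro s _
    positivity

lemma intervalIntegrable_ofReal_log :
    IntervalIntegrable (fun s : ℝ => (Real.log s : ℂ)) volume 0 1 :=
  intervalIntegrable_iff.2 (intervalIntegrable_iff.1 intervalIntegral.intervalIntegrable_log').ofReal

lemma intervalIntegrable_ofReal_log_sq :
    IntervalIntegrable (fun s : ℝ => (Real.log s : ℂ) ^ 2) volume 0 1 := by
  simpa using intervalIntegrable_iff.2
    ((intervalIntegrable_iff.1 intervalIntegrable_log_sq).ofReal (𝕜 := ℂ))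

/-- Integration of the derivative of `s ↦ h(s) / (1 - w s)`. -/
lemma integral_deriv_div_one_sub_mul {w : ℂ} (hw : 1 - w ∈ Complex.slitPlane) {h h' : ℝ → ℂ}
    (hc : ContinuousOn h (Icc 0 1)) (hd : ∀ s ∈ Ioo (0 : ℝ) 1, HasDerivAt h (h' s) s)
    (h0 : h 0 = 0) (h1 : h 1 = 0)
    (hi : IntervalIntegrable (fun s : ℝ => h' s / (1 - w * s) + w * h s / (1 - w * s) ^ 2)
      volume 0 1) :
    ∫ s in (0 : ℝ)..1, (h' s / (1 - w * s) + w * h s / (1 - w * s) ^ 2) = 0 := by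
  rw [intervalIntegral.integral_eq_sub_of_hasDerivAt_of_le zero_le_one
    (f := fun s : ℝ => h s / (1 - w * s)) ?_ ?_ hi]
  · simp [h0, h1]
  · exact hc.div (by fun_prop) fun s hs => one_sub_mul_ne_zero hw hs
  · intro s hs
    have hne := one_sub_mul_ne_zero hw (Ioo_subset_Icc_self hs)
    have h2 : HasDerivAt (fun s : ℝ => 1 - w * (s : ℂ)) (-w) s := by
      simpa using ((Complex.ofRealCLM.hasDerivAt (x := s)).const_mul w).const_sub 1
    refine ((hd s hs).fun_div h2 hne).congr_deriv ?_
    field_simp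
    ring

/-- The function `s log² s / (1 - w s)` vanishes at both ends, and its derivative is `log² s / (1 -
w s)² + 2 log s / (1 - w s)`. This is the step `w Li₃'(w) = Li₂(w)`; `integral_log_div_sq` and
`mul_integral_one_div` lead on from `Li₂` to `Li₁(w) = -log (1 - w)`. -/
lemma integral_log_sq_div {w : ℂ} (hw : 1 - w ∈ Complex.slitPlane) :
    ∫ s in (0 : ℝ)..1, (Real.log s : ℂ) ^ 2 / (1 - w * s) ^ 2 =
      -2 * ∫ s in (0 : ℝ)..1, (Real.log s : ℂ) / (1 - w * s) := by
  have i1 := intervalIntegrable_div_one_sub_mul_pow intervalIntegrable_ofReal_log_sq hw 2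
  have i2 := intervalIntegrable_div_one_sub_mul_pow intervalIntegrable_ofReal_log hw 1
  simp only [pow_one] at i2
  have key : ∀ s ∈ uIcc (0 : ℝ) 1,
      (Real.log s : ℂ) ^ 2 / (1 - w * s) ^ 2 + 2 * ((Real.log s : ℂ) / (1 - w * s)) =
      ((Real.log s : ℂ) ^ 2 + 2 * Real.log s) / (1 - w * s) +
        w * ((s * Real.log s ^ 2 : ℝ) : ℂ) / (1 - w * s) ^ 2 := by
    intro s hs
    rw [uIcc_of_le zero_le_one] at hs
    have := one_sub_mul_ne_zero hw hs
    push_cast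
    field_simp
    ring
  have hi := (i1.add (i2.const_mul 2)).congr (g := fun s : ℝ =>
    ((Real.log s : ℂ) ^ 2 + 2 * Real.log s) / (1 - w * s) +
      w * ((s * Real.log s ^ 2 : ℝ) : ℂ) / (1 - w * s) ^ 2)
    fun s hs => key s (uIoc_subset_uIcc hs)
  have h := integral_deriv_div_one_sub_mul hw (h := fun s => ((s * Real.log s ^ 2 : ℝ) : ℂ))
    (h' := fun s => (Real.log s : ℂ) ^ 2 + 2 * Real.log s)
    (Complex.continuous_ofReal.comp_continuousOn continuousOn_mul_log_sq) ?_ (by simp) (by simp) hi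
  · rw [← intervalIntegral.integral_congr key, intervalIntegral.integral_add i1 (i2.const_mul 2),
      intervalIntegral.integral_const_mul] at h
    linear_combination h
  · intro s hs
    have hl := Real.hasDerivAt_log hs.1.ne'
    have := hs.1.ne'
    refine ((hasDerivAt_id' s).fun_mul (hl.fun_pow 2)).ofReal_comp.congr_deriv ?_
    have : (s : ℂ) ≠ 0 := by exact_mod_cast this
    push_cast
    field_simp

lemma integral_log_div_sq {w : ℂ} (hw : 1 - w ∈ Complex.slitPlane) :
    ∫ s in (0 : ℝ)..1, (Real.log s : ℂ) / (1 - w * s) ^ 2 =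
      - ∫ s in (0 : ℝ)..1, 1 / (1 - w * s) := by
  have i1 := intervalIntegrable_div_one_sub_mul_pow intervalIntegrable_ofReal_log hw 2
  have i2 := intervalIntegrable_div_one_sub_mul_pow
    (intervalIntegrable_const (c := (1 : ℂ))) hw 1
  simp only [pow_one] at i2
  have key : ∀ s ∈ uIcc (0 : ℝ) 1,
      (Real.log s : ℂ) / (1 - w * s) ^ 2 + (1 / (1 - w * s)) =
      ((Real.log s : ℂ) + 1) / (1 - w * s) +
        w * ((s * Real.log s : ℝ) : ℂ) / (1 - w * s) ^ 2 := by
    intro s hs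
    rw [uIcc_of_le zero_le_one] at hs
    have := one_sub_mul_ne_zero hw hs
    push_cast
    field_simp
    ring
  have hi := (i1.add i2).congr (g := fun s : ℝ =>
    ((Real.log s : ℂ) + 1) / (1 - w * s) +
      w * ((s * Real.log s : ℝ) : ℂ) / (1 - w * s) ^ 2)
    fun s hs => key s (uIoc_subset_uIcc hs)
  have h := integral_deriv_div_one_sub_mul hw (h := fun s => ((s * Real.log s : ℝ) : ℂ))
    (h' := fun s => (Real.log s : ℂ) + 1)
    (Complex.continuous_ofReal.comp_continuousOn Real.continuous_mul_log.continuousOn)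
    ?_ (by simp) (by simp) hi
  · rw [← intervalIntegral.integral_congr key, intervalIntegral.integral_add i1 i2] at h
    linear_combination h
  · intro s hs
    have hl := Real.hasDerivAt_log hs.1.ne'
    have := hs.1.ne'
    refine ((hasDerivAt_id' s).fun_mul hl).ofReal_comp.congr_deriv ?_
    simp [this]

lemma mul_integral_one_div {w : ℂ} (hw : 1 - w ∈ Complex.slitPlane) :
    w * ∫ s in (0 : ℝ)..1, 1 / (1 - w * s) = -Complex.log (1 - w) := by
  have i2 := intervalIntegrable_div_one_sub_mul_pow
    (intervalIntegrable_const (c := (1 : ℂ))) hw 1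
  simp only [pow_one] at i2
  rw [← intervalIntegral.integral_const_mul,
    intervalIntegral.integral_eq_sub_of_hasDerivAt (f := fun s : ℝ => -Complex.log (1 - w * s)) ?_
      (i2.const_mul w)]
  · simp
  · intro s hs
    rw [uIcc_of_le zero_le_one] at hs
    have h2 : HasDerivAt (fun s : ℝ => 1 - w * (s : ℂ)) (-w) s := by
      simpa using ((Complex.ofRealCLM.hasDerivAt (x := s)).const_mul w).const_sub 1
    refine (h2.clog_real (one_sub_mul_mem_slitPlane hw hs.1 hs.2)).fun_neg.congr_deriv ?_
    ring

/-- The complement of the branch cuts of `trigF`. -/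
def trigDomain : Set ℂ := {z | 1 - Complex.exp (-2 * Complex.I * z) ∈ Complex.slitPlane}

lemma isOpen_trigDomain : IsOpen trigDomain :=
  Complex.isOpen_slitPlane.preimage (by fun_prop)

lemma hasDerivAt_exp_neg_two_I (z : ℂ) :
    HasDerivAt (fun z => Complex.exp (-2 * Complex.I * z))
      (-2 * Complex.I * Complex.exp (-2 * Complex.I * z)) z := by
  have := ((hasDerivAt_id z).const_mul (-2 * Complex.I)).cexp
  simpa [mul_comm] using this

/-- The first derivative of `trigF`. -/
def trigF1 (z : ℂ) : ℂ :=
  Complex.I / 2 * z ^ 2 + Complex.I / 2 * ∫ s in (0 : ℝ)..1,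
    Complex.exp (-2 * Complex.I * z) * (Real.log s : ℂ) /
      (1 - Complex.exp (-2 * Complex.I * z) * s)

/-- The second derivative of `trigF`. -/
def trigF2 (z : ℂ) : ℂ :=
  Complex.I * z + Complex.log (1 - Complex.exp (-2 * Complex.I * z))

lemma hasDerivAt_trigF {z : ℂ} (hz : z ∈ trigDomain) : HasDerivAt trigF (trigF1 z) z := by
  have h1 := ((hasDerivAt_integral_mul_div intervalIntegrable_ofReal_log_sq hz).const_mul
    (1 / 2)).comp z (hasDerivAt_exp_neg_two_I z)
  have h2 := ((hasDerivAt_id' z).fun_pow 3).const_mul (Complex.I / 6)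
  refine (h2.fun_add (h1.const_mul (1 / 4))).congr_deriv ?_
  rw [integral_log_sq_div hz, trigF1]
  have : ∀ s : ℝ, Complex.exp (-2 * Complex.I * z) * (Real.log s : ℂ) /
      (1 - Complex.exp (-2 * Complex.I * z) * s) = Complex.exp (-2 * Complex.I * z) *
      ((Real.log s : ℂ) / (1 - Complex.exp (-2 * Complex.I * z) * s)) := fun s => mul_div_assoc _ _ _
  simp_rw [this, intervalIntegral.integral_const_mul]
  simp
  ring

lemma hasDerivAt_trigF1 {z : ℂ} (hz : z ∈ trigDomain) : HasDerivAt trigF1 (trigF2 z) z := by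
  have h1 := (hasDerivAt_integral_mul_div intervalIntegrable_ofReal_log hz).comp z
    (hasDerivAt_exp_neg_two_I z)
  have h2 := ((hasDerivAt_id' z).fun_pow 2).const_mul (Complex.I / 2)
  refine (h2.fun_add (h1.const_mul (Complex.I / 2))).congr_deriv ?_
  rw [integral_log_div_sq hz, trigF2]
  have := mul_integral_one_div hz
  simp
  simp at this
  linear_combination (Complex.I ^ 2) * this +
    (-Complex.log (1 - Complex.exp (-(2 * Complex.I * z)))) * Complex.I_sq

lemma sin_ne_zero_of_mem_trigDomain {z : ℂ} (hz : z ∈ trigDomain) : Complex.sin z ≠ 0 := by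
  intro h
  apply Complex.slitPlane_ne_zero hz
  obtain ⟨k, rfl⟩ := Complex.sin_eq_zero_iff.1 h
  rw [sub_eq_zero, eq_comm, Complex.exp_eq_one_iff]
  exact ⟨-k, by push_cast; ring⟩

lemma hasDerivAt_trigF2 {z : ℂ} (hz : z ∈ trigDomain) :
    HasDerivAt trigF2 (Complex.cot z) z := by
  have h1 := ((hasDerivAt_exp_neg_two_I z).const_sub 1).clog hz
  have h2 := (hasDerivAt_id' z).const_mul Complex.I
  refine (h2.fun_add h1).congr_deriv ?_
  have h3 : 1 - Complex.exp (-2 * Complex.I * z) ≠ 0 := Complex.slitPlane_ne_zero hz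
  have h4 := sin_ne_zero_of_mem_trigDomain hz
  -- With `e^{-2iz} = (cos z - i sin z)²` one has `1 - e^{-2iz} = 2i sin z (cos z - i sin z)`, and a
  -- common factor cancels.
  have e : Complex.exp (-2 * Complex.I * z) =
      (Complex.cos z - Complex.sin z * Complex.I) ^ 2 := by
    rw [show -2 * Complex.I * z = ((2 : ℕ) : ℂ) * (-z * Complex.I) by push_cast; ring,
      Complex.exp_nat_mul, Complex.exp_mul_I]
    simp [sub_eq_add_neg]
  have e' : 1 - Complex.exp (-2 * Complex.I * z) =
      2 * Complex.sin z * Complex.I * (Complex.cos z - Complex.sin z * Complex.I) := by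
    rw [e]
    linear_combination (-1 : ℂ) * Complex.sin_sq_add_cos_sq z + Complex.sin z ^ 2 * Complex.I_sq
  rw [e'] at h3 ⊢
  have h5 := right_ne_zero_of_mul h3
  rw [e, Complex.cot_eq_cos_div_sin]
  field_simp
  ring

/-! ### Third derivatives of `F` and the WDVV matrices. -/

section

variable {V : Type*} [AddCommGroup V] [Module ℂ V]

lemma formG_apply (A : Finset (Module.Dual ℂ V)) (c : Module.Dual ℂ V → ℂ) (u v : V) :
    formG A c u v = ∑ α ∈ A, c α * (α u * α v) := by
  simp [formG, LinearMap.sum_apply, LinearMap.BilinForm.linMulLin_apply]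

lemma formG_comm (A : Finset (Module.Dual ℂ V)) (c : Module.Dual ℂ V → ℂ) (u v : V) :
    formG A c u v = formG A c v u := by
  simp [formG_apply, mul_comm]

lemma formG_vee [FiniteDimensional ℂ V] {A : Finset (Module.Dual ℂ V)}
    {c : Module.Dual ℂ V → ℂ} (hG : (formG A c).Nondegenerate) (α : Module.Dual ℂ V) (v : V) :
    formG A c (vee hG α) v = α v := by
  rw [vee, ← LinearMap.BilinForm.toDual_def hG, LinearEquiv.apply_symm_apply]

lemma eventually_mem_holDomain {A : Finset (Module.Dual ℂ V)} {P : V × ℂ}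
    (hP : P ∈ holDomain A) (v : V × ℂ) : ∀ᶠ t : ℂ in 𝓝 0, P + t • v ∈ holDomain A := by
  have : ∀ α ∈ A, ∀ᶠ t : ℂ in 𝓝 0, α P.1 + t * α v.1 ∈ trigDomain := by
    intro α hα
    refine (isOpen_trigDomain.preimage (f := fun t : ℂ => α P.1 + t * α v.1)
      (by fun_prop)).mem_nhds ?_
    have := hP α hα
    simpa [trigDomain] using this
  filter_upwards [(Filter.eventually_all_finset A).2 this] with t ht α hα
  have := ht α hα
  simpa [trigDomain] using this

/-- A line through a point of the domain stays in it for small parameters, so formulas valid on the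
domain can be differentiated again. -/
lemma lineDeriv_congr_holDomain {A : Finset (Module.Dual ℂ V)} {F G : V × ℂ → ℂ}
    (h : ∀ P ∈ holDomain A, F P = G P) {P : V × ℂ} (hP : P ∈ holDomain A) (v : V × ℂ) :
    lineDeriv ℂ F P v = lineDeriv ℂ G P v := by
  refine Filter.EventuallyEq.deriv_eq ?_
  filter_upwards [eventually_mem_holDomain hP v] with t ht using h _ ht

lemma hasDerivAt_covector_line (α : Module.Dual ℂ V) (P v : V × ℂ) :
    HasDerivAt (fun t : ℂ => α (P + t • v).1) (α v.1) 0 := by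
  simpa using ((hasDerivAt_id' (0 : ℂ)).mul_const (α v.1)).const_add (α P.1)

lemma hasDerivAt_snd_line (P v : V × ℂ) :
    HasDerivAt (fun t : ℂ => (P + t • v).2) v.2 0 := by
  simpa using ((hasDerivAt_id' (0 : ℂ)).mul_const v.2).const_add P.2

/-- The derivative of `prepotential` in the direction `v`. -/
def prepotential1 (A : Finset (Module.Dual ℂ V)) (c : Module.Dual ℂ V → ℂ) (lam : ℂ)
    (v P : V × ℂ) : ℂ :=
  P.2 ^ 2 * v.2 + (∑ α ∈ A, c α * (2 * α P.1 * α v.1)) * P.2 +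
    (∑ α ∈ A, c α * α P.1 ^ 2) * v.2 + lam * ∑ α ∈ A, c α * (trigF1 (α P.1) * α v.1)

/-- The second derivative of `prepotential` in the directions `v`, `u`. -/
def prepotential2 (A : Finset (Module.Dual ℂ V)) (c : Module.Dual ℂ V → ℂ) (lam : ℂ)
    (u v P : V × ℂ) : ℂ :=
  2 * P.2 * u.2 * v.2 + (∑ α ∈ A, c α * (2 * α u.1 * α v.1)) * P.2 +
    (∑ α ∈ A, c α * (2 * α P.1 * α v.1)) * u.2 + (∑ α ∈ A, c α * (2 * α P.1 * α u.1)) * v.2 +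
    lam * ∑ α ∈ A, c α * (trigF2 (α P.1) * α u.1 * α v.1)

lemma lineDeriv_prepotential (A : Finset (Module.Dual ℂ V)) (c : Module.Dual ℂ V → ℂ) (lam : ℂ)
    {P : V × ℂ} (hP : P ∈ holDomain A) (v : V × ℂ) :
    lineDeriv ℂ (prepotential A c lam) P v = prepotential1 A c lam v P := by
  have h2 := hasDerivAt_snd_line P v
  have h1 := fun α : Module.Dual ℂ V => hasDerivAt_covector_line α P v
  have h0 : P + (0 : ℂ) • v = P := by simp
  have hf : ∀ α ∈ A, HasDerivAt (fun t : ℂ => c α * trigF (α (P + t • v).1))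
      (c α * (trigF1 (α P.1) * α v.1)) 0 := by
    intro α hα
    have := (hasDerivAt_trigF (z := α (P + (0 : ℂ) • v).1) (by rw [h0]; exact hP α hα)).comp
      (0 : ℂ) (h1 α)
    rw [h0] at this
    exact this.const_mul _
  refine HasDerivAt.deriv ((((h2.fun_pow 3).const_mul (1 / 3)).fun_add
    ((HasDerivAt.fun_sum fun α _ => ((h1 α).fun_pow 2).const_mul (c α)).fun_mul h2)).fun_add
    ((HasDerivAt.fun_sum hf).const_mul lam) |>.congr_deriv ?_)
  rw [h0]
  simp [prepotential1]
  ring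

lemma lineDeriv_prepotential1 (A : Finset (Module.Dual ℂ V)) (c : Module.Dual ℂ V → ℂ) (lam : ℂ)
    {P : V × ℂ} (hP : P ∈ holDomain A) (u v : V × ℂ) :
    lineDeriv ℂ (prepotential1 A c lam v) P u = prepotential2 A c lam u v P := by
  have h2 := hasDerivAt_snd_line P u
  have h1 := fun α : Module.Dual ℂ V => hasDerivAt_covector_line α P u
  have h0 : P + (0 : ℂ) • u = P := by simp
  have hf : ∀ α ∈ A, HasDerivAt (fun t : ℂ => c α * (trigF1 (α (P + t • u).1) * α v.1))
      (c α * (trigF2 (α P.1) * α u.1 * α v.1)) 0 := by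
    intro α hα
    have := (hasDerivAt_trigF1 (z := α (P + (0 : ℂ) • u).1) (by rw [h0]; exact hP α hα)).comp
      (0 : ℂ) (h1 α)
    rw [h0] at this
    exact (this.mul_const _).const_mul _
  refine HasDerivAt.deriv (((((h2.fun_pow 2).mul_const v.2).fun_add
    ((HasDerivAt.fun_sum fun α _ => (((h1 α).const_mul 2).mul_const (α v.1)).const_mul
      (c α)).fun_mul h2)).fun_add
    ((HasDerivAt.fun_sum fun α _ => ((h1 α).fun_pow 2).const_mul (c α)).mul_const v.2)).fun_add
    ((HasDerivAt.fun_sum hf).const_mul lam) |>.congr_deriv ?_)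
  rw [h0]
  simp [prepotential2]
  ring

lemma lineDeriv_prepotential2 (A : Finset (Module.Dual ℂ V)) (c : Module.Dual ℂ V → ℂ) (lam : ℂ)
    {P : V × ℂ} (hP : P ∈ holDomain A) (s u v : V × ℂ) :
    lineDeriv ℂ (prepotential2 A c lam u v) P s =
      2 * s.2 * u.2 * v.2 + 2 * formG A c u.1 v.1 * s.2 + 2 * formG A c s.1 v.1 * u.2 +
      2 * formG A c s.1 u.1 * v.2 +
      lam * ∑ α ∈ A, c α * (Complex.cot (α P.1) * α s.1 * α u.1 * α v.1) := by
  have h2 := hasDerivAt_snd_line P s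
  have h1 := fun α : Module.Dual ℂ V => hasDerivAt_covector_line α P s
  have h0 : P + (0 : ℂ) • s = P := by simp
  have hf : ∀ α ∈ A, HasDerivAt (fun t : ℂ => c α * (trigF2 (α (P + t • s).1) * α u.1 * α v.1))
      (c α * (Complex.cot (α P.1) * α s.1 * α u.1 * α v.1)) 0 := by
    intro α hα
    have := (hasDerivAt_trigF2 (z := α (P + (0 : ℂ) • s).1) (by rw [h0]; exact hP α hα)).comp
      (0 : ℂ) (h1 α)
    rw [h0] at this
    exact ((this.mul_const _).mul_const _).const_mul _
  refine HasDerivAt.deriv (((((((h2.const_mul 2).mul_const u.2).mul_const v.2).fun_add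
    (h2.const_mul (∑ α ∈ A, c α * (2 * α u.1 * α v.1)))).fun_add
    ((HasDerivAt.fun_sum fun α _ => (((h1 α).const_mul 2).mul_const (α v.1)).const_mul
      (c α)).mul_const u.2)).fun_add
    ((HasDerivAt.fun_sum fun α _ => (((h1 α).const_mul 2).mul_const (α u.1)).const_mul
      (c α)).mul_const v.2)).fun_add
    ((HasDerivAt.fun_sum hf).const_mul lam) |>.congr_deriv ?_)
  have e : ∀ x y : V, 2 * formG A c x y = ∑ α ∈ A, c α * (2 * α x * α y) := fun x y => by
    rw [formG_apply, Finset.mul_sum]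
    exact Finset.sum_congr rfl fun _ _ => by ring
  simp only [e]

lemma thirdMatrix_apply {N : ℕ} (b : Module.Basis (Fin N) ℂ V)
    (A : Finset (Module.Dual ℂ V)) (c : Module.Dual ℂ V → ℂ) (lam : ℂ)
    {P : V × ℂ} (hP : P ∈ holDomain A) (i p q : Fin N ⊕ Unit) :
    thirdMatrix b (prepotential A c lam) P i p q =
      2 * (extBasis b i).2 * (extBasis b p).2 * (extBasis b q).2 +
      2 * formG A c (extBasis b p).1 (extBasis b q).1 * (extBasis b i).2 +
      2 * formG A c (extBasis b i).1 (extBasis b q).1 * (extBasis b p).2 +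
      2 * formG A c (extBasis b i).1 (extBasis b p).1 * (extBasis b q).2 +
      lam * ∑ α ∈ A, c α * (Complex.cot (α P.1) * α (extBasis b i).1 * α (extBasis b p).1 *
        α (extBasis b q).1) := by
  rw [← lineDeriv_prepotential2 A c lam hP]
  rw [thirdMatrix, Matrix.of_apply]
  refine lineDeriv_congr_holDomain (fun P₁ hP₁ => ?_) hP _
  rw [← lineDeriv_prepotential1 A c lam hP₁]
  exact lineDeriv_congr_holDomain (fun P₂ hP₂ => lineDeriv_prepotential A c lam hP₂ _) hP₁ _

/-- The matrix `λ ∑ c_α cot(α(x)) α_i α_p α_q`. -/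
def cotMatrix {N : ℕ} (b : Module.Basis (Fin N) ℂ V) (A : Finset (Module.Dual ℂ V))
    (c : Module.Dual ℂ V → ℂ) (lam : ℂ) (x : V) (i : Fin N) : Matrix (Fin N) (Fin N) ℂ :=
  Matrix.of fun p q => lam * ∑ α ∈ A, c α * (Complex.cot (α x) * α (b i) * α (b p) * α (b q))

lemma thirdMatrix_inl {N : ℕ} (b : Module.Basis (Fin N) ℂ V)
    (A : Finset (Module.Dual ℂ V)) (c : Module.Dual ℂ V → ℂ) (lam : ℂ)
    {P : V × ℂ} (hP : P ∈ holDomain A) (i : Fin N) :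
    thirdMatrix b (prepotential A c lam) P (Sum.inl i) =
      Matrix.fromBlocks (cotMatrix b A c lam P.1 i)
        (Matrix.of fun p _ => 2 * formG A c (b i) (b p))
        (Matrix.of fun _ q => 2 * formG A c (b i) (b q)) 0 := by
  ext p q
  rw [thirdMatrix_apply b A c lam hP]
  rcases p with p | p <;> rcases q with q | q <;> simp [extBasis, cotMatrix]

lemma thirdMatrix_inr {N : ℕ} (b : Module.Basis (Fin N) ℂ V)
    (A : Finset (Module.Dual ℂ V)) (c : Module.Dual ℂ V → ℂ) (lam : ℂ)
    {P : V × ℂ} (hP : P ∈ holDomain A) :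
    thirdMatrix b (prepotential A c lam) P (Sum.inr ()) =
      Matrix.fromBlocks ((2 : ℂ) • LinearMap.BilinForm.toMatrix b (formG A c)) 0 0
        ((2 : ℂ) • 1) := by
  ext p q
  rw [thirdMatrix_apply b A c lam hP]
  rcases p with p | p <;> rcases q with q | q <;> simp [extBasis]

lemma thirdMatrix_inr_inv {N : ℕ} (b : Module.Basis (Fin N) ℂ V)
    {A : Finset (Module.Dual ℂ V)} {c : Module.Dual ℂ V → ℂ} (hG : (formG A c).Nondegenerate)
    (lam : ℂ) {P : V × ℂ} (hP : P ∈ holDomain A) :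
    (thirdMatrix b (prepotential A c lam) P (Sum.inr ()))⁻¹ =
      Matrix.fromBlocks ((1 / 2 : ℂ) • (LinearMap.BilinForm.toMatrix b (formG A c))⁻¹) 0 0
        ((1 / 2 : ℂ) • 1) := by
  have hdet : IsUnit (LinearMap.BilinForm.toMatrix b (formG A c)).det :=
    ((LinearMap.BilinForm.nondegenerate_iff_det_ne_zero b).1 hG).isUnit
  refine Matrix.inv_eq_right_inv ?_
  rw [thirdMatrix_inr b A c lam hP, Matrix.fromBlocks_multiply]
  simp [smul_smul, Matrix.mul_nonsing_inv _ hdet, Matrix.fromBlocks_one]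

/-- The Gram matrix sends the coordinates of `β^∨` to the values `β(e_q)`, so its inverse recovers
`β^∨` from these values. This is how `G(α^∨, β^∨)` enters the WDVV equations. -/
lemma gram_inv_bilin [FiniteDimensional ℂ V] {N : ℕ} (b : Module.Basis (Fin N) ℂ V)
    {A : Finset (Module.Dual ℂ V)} {c : Module.Dual ℂ V → ℂ} (hG : (formG A c).Nondegenerate)
    (α β : Module.Dual ℂ V) :
    ∑ p, ∑ q, α (b p) * (LinearMap.BilinForm.toMatrix b (formG A c))⁻¹ p q * β (b q) =
      formG A c (vee hG α) (vee hG β) := by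
  set M := LinearMap.BilinForm.toMatrix b (formG A c)
  have hdet : IsUnit M.det :=
    ((LinearMap.BilinForm.nondegenerate_iff_det_ne_zero b).1 hG).isUnit
  have h1 : Matrix.mulVec M (b.repr (vee hG β)) = fun q => β (b q) := by
    ext q
    rw [← formG_vee hG β, formG_comm]
    conv_rhs => rw [← b.sum_repr (vee hG β), map_sum]
    simp [Matrix.mulVec, dotProduct, M, mul_comm]
  have h2 : Matrix.mulVec M⁻¹ (fun q => β (b q)) = b.repr (vee hG β) := by
    rw [← h1, Matrix.mulVec_mulVec, Matrix.nonsing_inv_mul _ hdet, Matrix.one_mulVec]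
  rw [formG_vee]
  conv_rhs => rw [← b.sum_repr (vee hG β)]
  simp only [map_sum, map_smul, ← h2, Matrix.mulVec, dotProduct, smul_eq_mul, Finset.sum_mul]
  exact Finset.sum_congr rfl fun p _ => Finset.sum_congr rfl fun q _ => by ring

end

/-! ### Forms on `Λ²V` and the WDVV equations. -/

section

variable {V : Type*} [AddCommGroup V] [Module ℂ V]

lemma formB_wedge (α β : Module.Dual ℂ V) (u v : V) :
    formB α β (wedge u v) = 2 * (α u * β v - α v * β u) := by
  simp [formB, wedge]
  ring

lemma formB_swap (α β : Module.Dual ℂ V) (z : V ⊗[ℂ] V) : formB β α z = -formB α β z := by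
  simp [formB, wedge]

lemma formB_self (α : Module.Dual ℂ V) : formB α α = 0 := by
  simp [formB, wedge]

lemma formB_smul_right (α β : Module.Dual ℂ V) (k : ℂ) : formB α (k • β) = k • formB α β := by
  simp [formB, wedge, TensorProduct.tmul_smul, ← TensorProduct.smul_tmul', smul_sub]

lemma formB_add_right (α β γ : Module.Dual ℂ V) :
    formB α (β + γ) = formB α β + formB α γ := by
  simp [formB, wedge, TensorProduct.tmul_add, TensorProduct.add_tmul]
  abel

lemma formB_smul_left (α β : Module.Dual ℂ V) (k : ℂ) : formB (k • α) β = k • formB α β := by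
  simp [formB, wedge, TensorProduct.tmul_smul, ← TensorProduct.smul_tmul', smul_sub]

/-- The linear map `u ⊗ v ↦ u ∧ v`. -/
def wedgeMap : V ⊗[ℂ] V →ₗ[ℂ] V ⊗[ℂ] V :=
  LinearMap.id - (TensorProduct.comm ℂ V V).toLinearMap

lemma wedgeMap_tmul (u v : V) : wedgeMap (u ⊗ₜ[ℂ] v) = wedge u v := by
  simp [wedgeMap, wedge]

lemma altSquare_le_range : altSquare V ≤ LinearMap.range (wedgeMap (V := V)) := by
  refine Submodule.span_le.2 ?_
  rintro _ ⟨⟨u, v⟩, rfl⟩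
  exact ⟨u ⊗ₜ v, wedgeMap_tmul u v⟩

lemma wedge_mem_altSquare (u v : V) : wedge u v ∈ altSquare V :=
  Submodule.subset_span ⟨(u, v), rfl⟩

/-- Every element of `Λ²V` is a value of `wedgeMap`, so the form can be pulled back to `V ⊗ V` and
tested on basis tensors. -/
lemma eq_zero_on_altSquare_iff {ι : Type*} (b : Module.Basis ι ℂ V)
    (T : LinearMap.BilinForm ℂ (V ⊗[ℂ] V)) :
    (∀ z ∈ altSquare V, ∀ w ∈ altSquare V, T z w = 0) ↔
      ∀ i j p q, T (wedge (b i) (b j)) (wedge (b p) (b q)) = 0 := by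
  refine ⟨fun h i j p q => h _ (wedge_mem_altSquare _ _) _ (wedge_mem_altSquare _ _),
    fun h z hz w hw => ?_⟩
  obtain ⟨z, rfl⟩ := altSquare_le_range hz
  obtain ⟨w, rfl⟩ := altSquare_le_range hw
  have : T.compl₁₂ wedgeMap wedgeMap = 0 := by
    refine LinearMap.BilinForm.ext_basis (b.tensorProduct b) ?_
    rintro ⟨i, j⟩ ⟨p, q⟩
    simp [wedgeMap_tmul, h]
  exact LinearMap.congr_fun₂ this z w

/-- The bilinear form `∑ κ(α, β) B_{α,β} ⊗ B_{α,β}`. -/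
def pairForm (A : Finset (Module.Dual ℂ V)) (κ : Module.Dual ℂ V → Module.Dual ℂ V → ℂ) :
    LinearMap.BilinForm ℂ (V ⊗[ℂ] V) :=
  ∑ α ∈ A, ∑ β ∈ A, κ α β • LinearMap.BilinForm.linMulLin (formB α β) (formB α β)

lemma pairForm_apply (A : Finset (Module.Dual ℂ V))
    (κ : Module.Dual ℂ V → Module.Dual ℂ V → ℂ) (z w : V ⊗[ℂ] V) :
    pairForm A κ z w = ∑ α ∈ A, ∑ β ∈ A, κ α β * (formB α β z * formB α β w) := by
  simp [pairForm, LinearMap.sum_apply, LinearMap.BilinForm.linMulLin_apply]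

/-- The product expands into four sums with coefficient 4; exchanging `α` and `β` identifies them in
pairs. What remains is antisymmetrised in `u, v` only, like the commutator of the WDVV matrices. -/
lemma pairForm_wedge (A : Finset (Module.Dual ℂ V))
    {κ : Module.Dual ℂ V → Module.Dual ℂ V → ℂ} (hκ : ∀ α β, κ α β = κ β α) (u v u' v' : V) :
    pairForm A κ (wedge u v) (wedge u' v') =
      8 * (∑ α ∈ A, ∑ β ∈ A, κ α β * (α u * α u' * β v * β v') -
        ∑ α ∈ A, ∑ β ∈ A, κ α β * (α v * α u' * β u * β v')) := by
  have h1 : ∑ α ∈ A, ∑ β ∈ A, κ α β * (α v * α v' * β u * β u') =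
      ∑ α ∈ A, ∑ β ∈ A, κ α β * (α u * α u' * β v * β v') := by
    rw [Finset.sum_comm]
    refine Finset.sum_congr rfl fun β _ => Finset.sum_congr rfl fun α _ => ?_
    rw [hκ α β]; ring
  have h2 : ∑ α ∈ A, ∑ β ∈ A, κ α β * (α u * α v' * β v * β u') =
      ∑ α ∈ A, ∑ β ∈ A, κ α β * (α v * α u' * β u * β v') := by
    rw [Finset.sum_comm]
    refine Finset.sum_congr rfl fun β _ => Finset.sum_congr rfl fun α _ => ?_
    rw [hκ α β]; ring
  have h3 : pairForm A κ (wedge u v) (wedge u' v') =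
      4 * (∑ α ∈ A, ∑ β ∈ A, κ α β * (α u * α u' * β v * β v') +
        ∑ α ∈ A, ∑ β ∈ A, κ α β * (α v * α v' * β u * β u') -
        ∑ α ∈ A, ∑ β ∈ A, κ α β * (α u * α v' * β v * β u') -
        ∑ α ∈ A, ∑ β ∈ A, κ α β * (α v * α u' * β u * β v')) := by
    rw [pairForm_apply]
    simp only [← Finset.sum_add_distrib, ← Finset.sum_sub_distrib, Finset.mul_sum]
    refine Finset.sum_congr rfl fun β _ => Finset.sum_congr rfl fun α _ => ?_
    rw [formB_wedge, formB_wedge]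
    ring
  rw [h3, h1, h2]
  ring

lemma cotMatrix_mul [FiniteDimensional ℂ V] {N : ℕ} (b : Module.Basis (Fin N) ℂ V)
    {A : Finset (Module.Dual ℂ V)} {c : Module.Dual ℂ V → ℂ} (hG : (formG A c).Nondegenerate)
    (lam : ℂ) (x : V) (i j p q : Fin N) :
    (cotMatrix b A c lam x i * (LinearMap.BilinForm.toMatrix b (formG A c))⁻¹ *
      cotMatrix b A c lam x j) p q =
    lam ^ 2 * ∑ α ∈ A, ∑ β ∈ A, (c α * c β * formG A c (vee hG α) (vee hG β) *
      (Complex.cot (α x) * Complex.cot (β x))) * (α (b i) * α (b p) * β (b j) * β (b q)) := by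
  simp only [Matrix.mul_apply, cotMatrix, Matrix.of_apply, ← gram_inv_bilin b hG,
    Finset.mul_sum, Finset.sum_mul]
  simp only [Finset.sum_comm (s := A) (t := (Finset.univ : Finset (Fin N)))]
  rw [Finset.sum_comm]
  refine Finset.sum_congr rfl fun r _ => Finset.sum_congr rfl fun s _ => ?_
  rw [Finset.sum_comm]
  refine Finset.sum_congr rfl fun α _ => Finset.sum_congr rfl fun β _ => ?_
  ring

lemma gram_inv_mul_col {N : ℕ} (b : Module.Basis (Fin N) ℂ V)
    {A : Finset (Module.Dual ℂ V)} {c : Module.Dual ℂ V → ℂ} (hG : (formG A c).Nondegenerate)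
    (j : Fin N) :
    (LinearMap.BilinForm.toMatrix b (formG A c))⁻¹ *
      (Matrix.of fun p (_ : Unit) => 2 * formG A c (b j) (b p)) =
      Matrix.of fun p (_ : Unit) => if p = j then 2 else 0 := by
  have hdet : IsUnit (LinearMap.BilinForm.toMatrix b (formG A c)).det :=
    ((LinearMap.BilinForm.nondegenerate_iff_det_ne_zero b).1 hG).isUnit
  have h : (Matrix.of fun p (_ : Unit) => 2 * formG A c (b j) (b p)) =
      LinearMap.BilinForm.toMatrix b (formG A c) *
        Matrix.of fun p (_ : Unit) => if p = j then (2 : ℂ) else 0 := by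
    ext p q
    simp [Matrix.mul_apply, formG_comm A c (b j), mul_comm]
  rw [h, Matrix.nonsing_inv_mul_cancel_left _ _ hdet]

lemma row_mul_gram_inv {N : ℕ} (b : Module.Basis (Fin N) ℂ V)
    {A : Finset (Module.Dual ℂ V)} {c : Module.Dual ℂ V → ℂ} (hG : (formG A c).Nondegenerate)
    (i : Fin N) :
    (Matrix.of fun (_ : Unit) q => 2 * formG A c (b i) (b q)) *
      (LinearMap.BilinForm.toMatrix b (formG A c))⁻¹ =
      Matrix.of fun (_ : Unit) q => if q = i then 2 else 0 := by
  have h := congrArg Matrix.transpose (gram_inv_mul_col b hG i)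
  have hsymm : (LinearMap.BilinForm.toMatrix b (formG A c)).transpose =
      LinearMap.BilinForm.toMatrix b (formG A c) := by
    ext p q
    simp [formG_comm A c (b p)]
  rw [Matrix.transpose_mul, Matrix.transpose_nonsing_inv, hsymm] at h
  exact h

/-- The WDVV equations as the vanishing of a bilinear form on `Λ²V`. -/
lemma wdvvOn_iff [FiniteDimensional ℂ V] {N : ℕ} (b : Module.Basis (Fin N) ℂ V)
    {A : Finset (Module.Dual ℂ V)} {c : Module.Dual ℂ V → ℂ} (hG : (formG A c).Nondegenerate)
    (lam : ℂ) :
    WDVVOn b (prepotential A c lam) (holDomain A) ↔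
      ∀ P ∈ holDomain A, ∀ z ∈ altSquare V, ∀ w ∈ altSquare V,
        pairForm A (fun α β => c α * c β) z w + lam ^ 2 / 4 *
          pairForm A (fun α β => c α * c β * formG A c (vee hG α) (vee hG β) *
            (Complex.cot (α P.1) * Complex.cot (β P.1))) z w = 0 := by
  refine forall₂_congr fun P hP => ?_
  have key := eq_zero_on_altSquare_iff b (pairForm A (fun α β => c α * c β) + (lam ^ 2 / 4) •
          pairForm A (fun α β => c α * c β * formG A c (vee hG α) (vee hG β) *
            (Complex.cot (α P.1) * Complex.cot (β P.1))))
  simp only [LinearMap.add_apply, LinearMap.smul_apply, smul_eq_mul] at key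
  rw [key]
  refine forall₂_congr fun i j => ?_
  simp only [thirdMatrix_inl b A c lam hP, thirdMatrix_inr_inv b hG lam hP,
    Matrix.fromBlocks_multiply, Matrix.fromBlocks_inj]
  have hGG : ∀ u u' v v' : V, ∑ α ∈ A, ∑ β ∈ A, c α * c β * (α u * α u' * β v * β v') =
      formG A c u u' * formG A c v v' := by
    intro u u' v v'
    rw [formG_apply, formG_apply, Finset.sum_mul_sum]
    exact Finset.sum_congr rfl fun _ _ => Finset.sum_congr rfl fun _ _ => by ring
  set M := LinearMap.BilinForm.toMatrix b (formG A c) with hM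
  set X : V → V → V → V → ℂ := fun u u' v v' => ∑ α ∈ A, ∑ β ∈ A,
    (c α * c β * formG A c (vee hG α) (vee hG β) *
      (Complex.cot (α P.1) * Complex.cot (β P.1))) * (α u * α u' * β v * β v') with hX
  -- The three blocks involving the `y`-direction are symmetric in `i, j` in any case, because `M⁻¹`
  -- turns the column `2 G(e_j, ·)` into twice a unit vector. The condition is in the upper left
  -- block.
  have h12 : ∀ i j, cotMatrix b A c lam P.1 i * ((1 / 2 : ℂ) • M⁻¹) *
      (Matrix.of fun p (_ : Unit) => 2 * formG A c (b j) (b p)) =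
      cotMatrix b A c lam P.1 j * ((1 / 2 : ℂ) • M⁻¹) *
      (Matrix.of fun p (_ : Unit) => 2 * formG A c (b i) (b p)) := by
    intro i j
    simp only [Matrix.mul_smul, Matrix.smul_mul, Matrix.mul_assoc, hM, gram_inv_mul_col b hG]
    ext p q
    simp [Matrix.mul_apply, cotMatrix, mul_comm, mul_left_comm]
  have h21 : ∀ i j, (Matrix.of fun (_ : Unit) q => 2 * formG A c (b i) (b q)) *
      ((1 / 2 : ℂ) • M⁻¹) * cotMatrix b A c lam P.1 j =
      (Matrix.of fun (_ : Unit) q => 2 * formG A c (b j) (b q)) *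
      ((1 / 2 : ℂ) • M⁻¹) * cotMatrix b A c lam P.1 i := by
    intro i j
    simp only [Matrix.mul_smul, Matrix.smul_mul, hM, row_mul_gram_inv b hG]
    ext p q
    simp [Matrix.mul_apply, cotMatrix, mul_comm, mul_left_comm]
  have h22 : ∀ i j, (Matrix.of fun (_ : Unit) q => 2 * formG A c (b i) (b q)) *
      ((1 / 2 : ℂ) • M⁻¹) * (Matrix.of fun p (_ : Unit) => 2 * formG A c (b j) (b p)) =
      (Matrix.of fun (_ : Unit) q => 2 * formG A c (b j) (b q)) *
      ((1 / 2 : ℂ) • M⁻¹) * (Matrix.of fun p (_ : Unit) => 2 * formG A c (b i) (b p)) := by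
    intro i j
    simp only [Matrix.mul_smul, Matrix.smul_mul, hM, row_mul_gram_inv b hG]
    ext p q
    simp [Matrix.mul_apply, formG_comm A c (b i) (b j)]
  have h11 : ∀ i j p q, (cotMatrix b A c lam P.1 i * ((1 / 2 : ℂ) • M⁻¹) *
      cotMatrix b A c lam P.1 j) p q = lam ^ 2 / 2 * X (b i) (b p) (b j) (b q) := by
    intro i j p q
    simp only [Matrix.mul_smul, Matrix.smul_mul, Matrix.smul_apply, hM, cotMatrix_mul b hG, hX,
      smul_eq_mul]
    ring
  simp only [Matrix.mul_zero, Matrix.zero_mul, add_zero, zero_add, h12 i j, h21 i j, h22 i j,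
    and_true]
  rw [← Matrix.ext_iff]
  refine forall₂_congr fun p q => ?_
  rw [pairForm_wedge A (fun _ _ => mul_comm _ _), pairForm_wedge A (fun α β => by
    rw [formG_comm A c (vee hG α)]; ring)]
  simp only [Matrix.add_apply, h11, hGG]
  -- The upper left block is the sum of `2 G G` and `(λ²/2) X`; the factor 4 matches the 8 of
  -- `pairForm_wedge`.
  rw [← sub_eq_zero, ← mul_right_inj' (show (4 : ℂ) ≠ 0 by norm_num), mul_zero]
  refine Eq.congr ?_ rfl
  simp [Matrix.mul_apply, hX]
  ring

end

/-! ### The cotangent and the poles of cotangent sums. -/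

section

lemma cot_neg (z : ℂ) : Complex.cot (-z) = -Complex.cot z := by
  simp [Complex.cot, neg_div', div_neg]

lemma cot_add_int_mul_pi (z : ℂ) (k : ℤ) : Complex.cot (z + k * Real.pi) = Complex.cot z := by
  have h : ∀ z : ℂ, Complex.cot (z + Real.pi) = Complex.cot z := fun z => by
    simp [Complex.cot, Complex.cos_add_pi, Complex.sin_add_pi]
  exact Function.Periodic.int_mul h k z

lemma sin_add_int_mul_pi_ne_zero {z : ℂ} (hz : Complex.sin z ≠ 0) (k : ℤ) :
    Complex.sin (z + k * Real.pi) ≠ 0 := by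
  rw [Ne, Complex.sin_eq_zero_iff] at hz ⊢
  rintro ⟨m, hm⟩
  exact hz ⟨m - k, by push_cast; linear_combination hm⟩

lemma sin_ne_zero_of_im_ne_zero {z : ℂ} (hz : z.im ≠ 0) : Complex.sin z ≠ 0 := by
  intro h
  obtain ⟨k, rfl⟩ := Complex.sin_eq_zero_iff.1 h
  apply hz
  rw [← Complex.ofReal_intCast, ← Complex.ofReal_mul, Complex.ofReal_im]

lemma one_sub_exp_ne_zero {z : ℂ} (hz : Complex.sin z ≠ 0) :
    1 - Complex.exp (2 * Complex.I * z) ≠ 0 := by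
  intro h
  obtain ⟨k, hk⟩ := Complex.exp_eq_one_iff.1 (sub_eq_zero.1 h).symm
  refine hz (Complex.sin_eq_zero_iff.2 ⟨k, ?_⟩)
  have : 2 * Complex.I * (z - k * Real.pi) = 0 := by linear_combination hk
  simpa [sub_eq_zero] using this

/-- In the variable `q = e^{2iz}` this shows the limit `-i` for `Im z → ∞` as well as the
exponentially small correction, which `sum_leading_eq_zero` needs. -/
lemma cot_eq_neg_I_sub {z : ℂ} (hz : Complex.sin z ≠ 0) :
    Complex.cot z = -Complex.I - 2 * Complex.I *
      (Complex.exp (2 * Complex.I * z) / (1 - Complex.exp (2 * Complex.I * z))) := by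
  have h := one_sub_exp_ne_zero hz
  rw [Complex.cot_eq_exp_ratio]
  have e := div_mul_cancel₀ (Complex.exp (2 * Complex.I * z)) h
  rw [div_eq_iff (mul_ne_zero Complex.I_ne_zero h)]
  linear_combination (1 + Complex.exp (2 * Complex.I * z)) * Complex.I_sq + 2 * Complex.I ^ 2 * e

lemma tendsto_exp_two_I_mul :
    Tendsto (fun z => Complex.exp (2 * Complex.I * z)) (comap Complex.im atTop) (𝓝 0) := by
  refine Complex.tendsto_exp_comap_re_atBot.comp (tendsto_comap_iff.2 ?_)
  have : Complex.re ∘ (fun z => 2 * Complex.I * z) = (fun y : ℝ => -2 * y) ∘ Complex.im := by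
    ext z; simp
  rw [this]
  exact (tendsto_id.const_mul_atTop_of_neg (by norm_num)).comp tendsto_comap

lemma tendsto_cot_im_atTop :
    Tendsto Complex.cot (comap Complex.im atTop) (𝓝 (-Complex.I)) := by
  have h := tendsto_exp_two_I_mul
  have h2 : Tendsto (fun z => -Complex.I - 2 * Complex.I *
      (Complex.exp (2 * Complex.I * z) / (1 - Complex.exp (2 * Complex.I * z))))
      (comap Complex.im atTop) (𝓝 (-Complex.I - 2 * Complex.I * (0 / (1 - 0)))) :=
    ((h.div (h.const_sub 1) (by simp)).const_mul _).const_sub _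
  simp only [zero_div, mul_zero, sub_zero] at h2
  refine h2.congr' ?_
  filter_upwards [preimage_mem_comap (Ioi_mem_atTop (0 : ℝ))] with z hz
  exact (cot_eq_neg_I_sub (sin_ne_zero_of_im_ne_zero (ne_of_gt hz))).symm

lemma tendsto_cot_im_atBot :
    Tendsto Complex.cot (comap Complex.im atBot) (𝓝 Complex.I) := by
  have h : Tendsto (fun z : ℂ => -z) (comap Complex.im atBot) (comap Complex.im atTop) :=
    tendsto_comap_iff.2 (tendsto_neg_atBot_atTop.comp tendsto_comap)
  simpa [cot_neg] using (tendsto_cot_im_atTop.comp h).neg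

lemma differentiableAt_cot_line {a : ℂ} (n t : ℂ) (h : Complex.sin (a + t * n) ≠ 0) :
    DifferentiableAt ℂ (fun t => Complex.cot (a + t * n)) t :=
  DifferentiableAt.div (by fun_prop) (by fun_prop) h

/-- The residue of the cotangent. -/
lemma tendsto_mul_cot_line {a n : ℂ} (ha : Complex.sin a = 0) (hn : n ≠ 0) :
    Tendsto (fun t => t * Complex.cot (a + t * n)) (𝓝[≠] 0) (𝓝 n⁻¹) := by
  have hc : Complex.cos a ≠ 0 := fun h => by
    have := Complex.sin_sq_add_cos_sq a
    simp [ha, h] at this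
  have h1 : HasDerivAt (fun t : ℂ => Complex.sin (a + t * n)) (Complex.cos a * n) 0 := by
    have := (((hasDerivAt_id' (0 : ℂ)).mul_const n).const_add a).csin
    simpa using this
  have h2 := hasDerivAt_iff_tendsto_slope_zero.1 h1
  have h3 : Tendsto (fun t : ℂ => Complex.cos (a + t * n)) (𝓝[≠] 0) (𝓝 (Complex.cos a)) := by
    have : Continuous fun t : ℂ => Complex.cos (a + t * n) := by fun_prop
    simpa using (this.tendsto 0).mono_left nhdsWithin_le_nhds
  have h4 := h3.div h2 (mul_ne_zero hc hn)
  have e : Complex.cos a / (Complex.cos a * n) = n⁻¹ := by field_simp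
  rw [e] at h4
  refine h4.congr' ?_
  filter_upwards [self_mem_nhdsWithin] with t ht
  have : t ≠ 0 := ht
  simp [ha, Complex.cot, div_eq_mul_inv]
  ring

lemma eventually_sin_line_ne_zero (a : ℂ) {n : ℂ} (hn : n ≠ 0) :
    ∀ᶠ t in 𝓝[≠] (0 : ℂ), Complex.sin (a + t * n) ≠ 0 := by
  have hd : HasDerivAt (fun t : ℂ => Complex.sin (a + t * n)) (Complex.cos a * n) 0 := by
    have := (((hasDerivAt_id' (0 : ℂ)).mul_const n).const_add a).csin
    simpa using this
  by_cases ha : Complex.sin a = 0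
  · have hc : Complex.cos a ≠ 0 := fun h => by
      have := Complex.sin_sq_add_cos_sq a
      simp [ha, h] at this
    exact hd.eventually_ne (mul_ne_zero hc hn)
  · refine (hd.continuousAt.eventually_ne ?_).filter_mono nhdsWithin_le_nhds
    simpa using ha

variable {ι : Type*}

/-- The restriction of `∑ κ(α, β) cot α cot β` to a line. -/
def cotSum (s : Finset ι) (κ : ι → ι → ℂ) (a n : ι → ℂ) (t : ℂ) : ℂ :=
  ∑ i ∈ s, ∑ j ∈ s, κ i j * (Complex.cot (a i + t * n i) * Complex.cot (a j + t * n j))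

lemma cotSum_add (s : Finset ι) (κ : ι → ι → ℂ) (a n : ι → ℂ) (t₀ t : ℂ) :
    cotSum s κ a n (t + t₀) = cotSum s κ (fun i => a i + t₀ * n i) n t := by
  have : ∀ i, a i + (t + t₀) * n i = a i + t₀ * n i + t * n i := fun i => by ring
  simp only [cotSum, this]

lemma differentiableAt_cotSum {s : Finset ι} (κ : ι → ι → ℂ) {a n : ι → ℂ} {t : ℂ}
    (h : ∀ i ∈ s, Complex.sin (a i + t * n i) ≠ 0) : DifferentiableAt ℂ (cotSum s κ a n) t := by
  refine DifferentiableAt.fun_sum fun i hi => DifferentiableAt.fun_sum fun j hj => ?_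
  exact ((differentiableAt_cot_line _ _ (h i hi)).mul
    (differentiableAt_cot_line _ _ (h j hj))).const_mul _

/-- `S` will be the set of indices singular at the point considered. Since `κ` vanishes on `S × S`,
no two poles are multiplied; the two mixed blocks agree by symmetry. -/
lemma cotSum_eq_add {s S R : Finset ι} {κ : ι → ι → ℂ} (hκ : ∀ i j, κ i j = κ j i) {a n : ι → ℂ}
    (hsplit : ∀ g : ι → ℂ, ∑ i ∈ S, g i + ∑ i ∈ R, g i = ∑ i ∈ s, g i)
    (hSS : ∀ i ∈ S, ∀ j ∈ S, κ i j = 0) (t : ℂ) :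
    cotSum s κ a n t = 2 * ∑ i ∈ S, Complex.cot (a i + t * n i) *
        ∑ j ∈ R, κ i j * Complex.cot (a j + t * n j) +
      ∑ i ∈ R, ∑ j ∈ R, κ i j * (Complex.cot (a i + t * n i) * Complex.cot (a j + t * n j)) := by
  set f : ι → ℂ := fun i => Complex.cot (a i + t * n i) with hf
  have e1 : ∑ i ∈ S, ∑ j ∈ S, κ i j * (f i * f j) = 0 :=
    Finset.sum_eq_zero fun i hi => Finset.sum_eq_zero fun j hj => by rw [hSS i hi j hj, zero_mul]
  have e2 : ∑ i ∈ S, ∑ j ∈ R, κ i j * (f i * f j) = ∑ i ∈ S, f i * ∑ j ∈ R, κ i j * f j := by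
    simp only [Finset.mul_sum]
    exact Finset.sum_congr rfl fun i _ => Finset.sum_congr rfl fun j _ => by ring
  have e3 : ∑ i ∈ R, ∑ j ∈ S, κ i j * (f i * f j) = ∑ i ∈ S, ∑ j ∈ R, κ i j * (f i * f j) := by
    rw [Finset.sum_comm]
    exact Finset.sum_congr rfl fun i _ => Finset.sum_congr rfl fun j _ => by rw [hκ j i]; ring
  change ∑ i ∈ s, ∑ j ∈ s, κ i j * (f i * f j) = _
  simp only [← hsplit, Finset.sum_add_distrib, e1, e3, e2]
  ring

/-- Each singular cotangent has a simple pole, and its cofactor is regular and vanishes at `t = 0`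
by `hres`, hence is `O(t)`. -/
lemma cotSum_isBigO_one {s : Finset ι} {κ : ι → ι → ℂ} (hκ : ∀ i j, κ i j = κ j i) {a n : ι → ℂ}
    (hn : ∀ i ∈ s, n i ≠ 0)
    (hsing : ∀ i ∈ s, Complex.sin (a i) = 0 → ∀ j ∈ s, Complex.sin (a j) = 0 → κ i j = 0)
    (hres : ∀ i ∈ s, Complex.sin (a i) = 0 → ∑ j ∈ s, κ i j * Complex.cot (a j) = 0) :
    cotSum s κ a n =O[𝓝[≠] 0] (fun _ => (1 : ℂ)) := by
  classical
  set f : ι → ℂ → ℂ := fun i t => Complex.cot (a i + t * n i) with hf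
  set S := s.filter fun i => Complex.sin (a i) = 0
  set R := s.filter fun i => ¬ Complex.sin (a i) = 0
  have hreg : ∀ i ∈ R, DifferentiableAt ℂ (f i) 0 := fun i hi =>
    differentiableAt_cot_line _ _ (by simpa using (Finset.mem_filter.1 hi).2)
  have hregO : ∀ i ∈ R, f i =O[𝓝[≠] 0] (fun _ => (1 : ℂ)) := fun i hi =>
    ((hreg i hi).continuousAt.tendsto.mono_left nhdsWithin_le_nhds).isBigO_one ℂ
  have hSS : ∀ i ∈ S, ∀ j ∈ S, κ i j = 0 := fun i hi j hj =>
    hsing i (Finset.mem_filter.1 hi).1 (Finset.mem_filter.1 hi).2 j (Finset.mem_filter.1 hj).1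
      (Finset.mem_filter.1 hj).2
  have hg : ∀ i ∈ S, (fun t => ∑ j ∈ R, κ i j * f j t) =O[𝓝[≠] 0] (fun t => t) := by
    intro i hi
    have hd : DifferentiableAt ℂ (fun t => ∑ j ∈ R, κ i j * f j t) 0 :=
      DifferentiableAt.fun_sum fun j hj => (hreg j hj).const_mul _
    have h0 : ∑ j ∈ R, κ i j * f j 0 = 0 := by
      have := hres i (Finset.mem_filter.1 hi).1 (Finset.mem_filter.1 hi).2
      rw [← Finset.sum_filter_add_sum_filter_not s fun i => Complex.sin (a i) = 0,
        Finset.sum_eq_zero (s := S) fun j hj => by rw [hSS i hi j hj, zero_mul],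
        zero_add] at this
      simpa [hf] using this
    have := hd.isBigO_sub
    simp only [h0, sub_zero] at this
    exact this.mono nhdsWithin_le_nhds
  have hcot : ∀ i ∈ S, (fun t => t * f i t) =O[𝓝[≠] 0] (fun _ => (1 : ℂ)) := fun i hi =>
    (tendsto_mul_cot_line (Finset.mem_filter.1 hi).2 (hn i (Finset.mem_filter.1 hi).1)).isBigO_one ℂ
  have hmain : ∀ i ∈ S, (fun t => f i t * ∑ j ∈ R, κ i j * f j t) =O[𝓝[≠] 0]
      (fun _ => (1 : ℂ)) := by
    intro i hi
    have h1 : (fun t => t⁻¹ * ∑ j ∈ R, κ i j * f j t) =O[𝓝[≠] 0] (fun t => t⁻¹ * t) :=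
      (Asymptotics.isBigO_refl (fun t : ℂ => t⁻¹) _).mul (hg i hi)
    have h2 := (hcot i hi).mul h1
    refine (h2.congr' ?_ ?_)
    · filter_upwards [self_mem_nhdsWithin] with t ht
      have : t ≠ 0 := ht
      field_simp
    · filter_upwards [self_mem_nhdsWithin] with t ht
      have : t ≠ 0 := ht
      field_simp
  have hdecomp : cotSum s κ a n = fun t => 2 * ∑ i ∈ S, f i t * ∑ j ∈ R, κ i j * f j t +
      ∑ i ∈ R, ∑ j ∈ R, κ i j * (f i t * f j t) :=
    funext (cotSum_eq_add hκ (Finset.sum_filter_add_sum_filter_not s _) hSS)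
  rw [hdecomp]
  refine Asymptotics.IsBigO.add ((Asymptotics.IsBigO.fun_sum hmain).const_mul_left 2)
    (Asymptotics.IsBigO.fun_sum fun i hi => Asymptotics.IsBigO.fun_sum fun j hj => ?_)
  simpa using ((hregO i hi).mul (hregO j hj)).const_mul_left (κ i j)

/-- The residue of a cotangent sum. -/
lemma tendsto_mul_cotSum {s : Finset ι} {κ : ι → ι → ℂ} (hκ : ∀ i j, κ i j = κ j i) {a n : ι → ℂ}
    (hn : ∀ i ∈ s, n i ≠ 0) {S : Finset ι} (hS : ∀ i, i ∈ S ↔ i ∈ s ∧ Complex.sin (a i) = 0)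
    (hSS : ∀ i ∈ S, ∀ j ∈ S, κ i j = 0) :
    Tendsto (fun t => t * cotSum s κ a n t) (𝓝[≠] 0)
      (𝓝 (2 * ∑ i ∈ S, (n i)⁻¹ * ∑ j ∈ s, κ i j * Complex.cot (a j))) := by
  classical
  set R := s.filter fun i => ¬ Complex.sin (a i) = 0
  have hS' : S = s.filter fun i => Complex.sin (a i) = 0 := by ext i; simp [hS]
  have hsplit : ∀ g : ι → ℂ, ∑ i ∈ S, g i + ∑ i ∈ R, g i = ∑ i ∈ s, g i := fun g => by
    rw [hS']; exact Finset.sum_filter_add_sum_filter_not s _ g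
  have hR : ∀ i ∈ R, Tendsto (fun t => Complex.cot (a i + t * n i)) (𝓝[≠] 0)
      (𝓝 (Complex.cot (a i))) := by
    intro i hi
    have := (differentiableAt_cot_line (a := a i) (n i) 0
      (by simpa using (Finset.mem_filter.1 hi).2)).continuousAt.tendsto
    simpa using this.mono_left (nhdsWithin_le_nhds (s := {0}ᶜ))
  have h1 := (tendsto_finsetSum S fun i hi => (tendsto_mul_cot_line ((hS i).1 hi).2
    (hn i ((hS i).1 hi).1)).mul (tendsto_finsetSum R fun j hj =>
      (hR j hj).const_mul (κ i j))).const_mul 2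
  have h2 := (tendsto_id.mono_left (nhdsWithin_le_nhds (a := (0 : ℂ)) (s := {0}ᶜ))).mul
    (tendsto_finsetSum R fun i hi => tendsto_finsetSum R fun j hj =>
      ((hR i hi).mul (hR j hj)).const_mul (κ i j))
  have h3 := h1.add h2
  rw [zero_mul, add_zero] at h3
  have h4 : ∀ i ∈ S, ∑ j ∈ R, κ i j * Complex.cot (a j) = ∑ j ∈ s, κ i j * Complex.cot (a j) :=
    fun i hi => by
      rw [← hsplit, Finset.sum_eq_zero (s := S) fun j hj => by rw [hSS i hi j hj, zero_mul],
        zero_add]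
  rw [Finset.sum_congr rfl fun i hi => by rw [h4 i hi]] at h3
  refine h3.congr fun t => ?_
  rw [cotSum_eq_add hκ hsplit hSS, mul_add, mul_left_comm t]
  simp only [mul_assoc, id, Finset.mul_sum S]

end

/-! ### Limits at `± i∞` and the Liouville argument. -/

section

/-- The sign of a non-zero real number, as a complex number. -/
def sgn (r : ℝ) : ℂ := if 0 < r then 1 else -1

lemma tendsto_cot_of_im_add_mul {X : Type*} {l : Filter X} {τ : X → ℝ} (hτ : Tendsto τ l atTop)
    {z : X → ℂ} {y r : ℝ} (hr : r ≠ 0) (hz : ∀ t, (z t).im = y + τ t * r) :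
    Tendsto (fun t => Complex.cot (z t)) l (𝓝 (-Complex.I * sgn r)) := by
  rcases hr.lt_or_gt with hr | hr
  · have h1 : Tendsto (fun t => (z t).im) l atBot := by
      simp only [hz]
      exact tendsto_atBot_add_const_left _ _ (hτ.atTop_mul_const_of_neg hr)
    simpa [sgn, hr.not_gt, Function.comp_def] using
      tendsto_cot_im_atBot.comp (tendsto_comap_iff.2 h1)
  · have h1 : Tendsto (fun t => (z t).im) l atTop := by
      simp only [hz]
      exact tendsto_atTop_add_const_left _ _ (hτ.atTop_mul_const hr)
    simpa [sgn, hr, Function.comp_def] using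
      tendsto_cot_im_atTop.comp (tendsto_comap_iff.2 h1)

variable {ι : Type*}

lemma tendsto_sum_cot_mul_cot {X : Type*} {l : Filter X} (s : Finset ι) (κ : ι → ι → ℂ)
    {ε : ι → ℂ} {z : ι → X → ℂ}
    (hz : ∀ i ∈ s, Tendsto (fun t => Complex.cot (z i t)) l (𝓝 (-Complex.I * ε i))) :
    Tendsto (fun t => ∑ i ∈ s, ∑ j ∈ s, κ i j * (Complex.cot (z i t) * Complex.cot (z j t))) l
      (𝓝 (-∑ i ∈ s, ∑ j ∈ s, κ i j * (ε i * ε j))) := by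
  have h := tendsto_finsetSum s fun i hi => tendsto_finsetSum s fun j hj =>
    ((hz i hi).mul (hz j hj)).const_mul (κ i j)
  convert h using 2
  simp only [← Finset.sum_neg_distrib]
  refine Finset.sum_congr rfl fun i _ => Finset.sum_congr rfl fun j _ => ?_
  linear_combination (-κ i j * ε i * ε j) * Complex.I_sq

/-- A removable singularity argument at all points at once. -/
lemma differentiable_limUnder {F : ℂ → ℂ} (hd : ∀ t₀, ∀ᶠ t in 𝓝[≠] t₀, DifferentiableAt ℂ F t)
    (hb : ∀ t₀, IsBoundedUnder (· ≤ ·) (𝓝[≠] t₀) fun t => ‖F t‖) :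
    Differentiable ℂ fun t => limUnder (𝓝[≠] t) F := by
  intro t₀
  have hU := eventually_nhdsWithin_iff.1 (hd t₀)
  have hdU : DifferentiableOn ℂ F ({t | t ∈ ({t₀}ᶜ : Set ℂ) → DifferentiableAt ℂ F t} \ {t₀}) :=
    fun t ht => (ht.1 ht.2).differentiableWithinAt
  obtain ⟨C, hC⟩ := hb t₀
  have hb' : IsBoundedUnder (· ≤ ·) (𝓝[≠] t₀) fun t => ‖F t - F t₀‖ :=
    ⟨C + ‖F t₀‖, by
      rw [eventually_map] at hC ⊢
      filter_upwards [hC] with t ht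
      exact norm_sub_le_of_le ht le_rfl⟩
  have h1 := Complex.differentiableOn_update_limUnder_of_isLittleO hU hdU
    hb'.isLittleO_sub_self_inv
  refine (h1.differentiableAt hU).congr_of_eventuallyEq ?_
  filter_upwards [hU] with t ht
  by_cases htt : t = t₀
  · subst htt; simp
  · rw [Function.update_of_ne htt]
    exact ((ht htt).continuousAt.tendsto.mono_left nhdsWithin_le_nhds).limUnder_eq

/-- An entire function of period `π` that has limits at `± i∞` is constant. -/
lemma eq_of_periodic_of_tendsto {g : ℂ → ℂ} (hg : Differentiable ℂ g)
    (hper : ∀ t, g (t + Real.pi) = g t) {L₁ L₂ : ℂ}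
    (h₁ : Tendsto g (comap Complex.im atTop) (𝓝 L₁))
    (h₂ : Tendsto g (comap Complex.im atBot) (𝓝 L₂)) (t : ℂ) : g t = L₁ := by
  have hb : ∃ C, ∀ t, ‖g t‖ ≤ C := by
    obtain ⟨s₁, hs₁, hs₁'⟩ := mem_comap.1 (h₁.norm.eventually_le_const (lt_add_one ‖L₁‖))
    obtain ⟨s₂, hs₂, hs₂'⟩ := mem_comap.1 (h₂.norm.eventually_le_const (lt_add_one ‖L₂‖))
    obtain ⟨M₁, hM₁⟩ := mem_atTop_sets.1 hs₁
    obtain ⟨M₂, hM₂⟩ := mem_atBot_sets.1 hs₂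
    obtain ⟨C, hC⟩ := ((isCompact_Icc (a := (0 : ℝ)) (b := Real.pi)).reProdIm
      (isCompact_Icc (a := M₂) (b := M₁))).exists_bound_of_continuousOn hg.continuous.continuousOn
    refine ⟨max C (max (‖L₁‖ + 1) (‖L₂‖ + 1)), fun t => ?_⟩
    rcases le_or_gt M₁ t.im with h | h
    · exact (hs₁' (hM₁ _ h)).trans ((le_max_left _ _).trans (le_max_right _ _))
    rcases le_or_gt t.im M₂ with h' | h'
    · exact (hs₂' (hM₂ _ h')).trans ((le_max_right _ _).trans (le_max_right _ _))
    refine le_trans ?_ (le_max_left _ _)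
    -- Between the two half-planes controlled by the limits, periodicity moves `t` into a compact
    -- rectangle.
    obtain ⟨k, hk, -⟩ := existsUnique_add_zsmul_mem_Ico Real.pi_pos t.re 0
    have hp : g (t + k * Real.pi) = g t :=
      Function.Periodic.int_mul (f := g) (c := (Real.pi : ℂ)) hper k t
    rw [← hp]
    refine hC _ ⟨?_, ?_⟩
    · simp at hk ⊢
      exact ⟨hk.1, hk.2.le⟩
    · simp
      exact ⟨h'.le, h.le⟩
  obtain ⟨C, hC⟩ := hb
  have hconst : ∀ u, g u = g t := fun u => hg.apply_eq_apply_of_bounded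
    (isBounded_iff_forall_norm_le.2 ⟨C, by rintro _ ⟨x, rfl⟩; exact hC x⟩) u t
  have hne : (comap Complex.im (atTop : Filter ℝ)).NeBot :=
    atTop_neBot.comap_of_surj Complex.im_surjective
  refine tendsto_nhds_unique ?_ h₁
  exact tendsto_const_nhds.congr fun u => (hconst u).symm

/-- A cotangent sum without poles on a line is given by its limit at infinity. -/
lemma cotSum_eq_of_residues {s : Finset ι} {κ : ι → ι → ℂ} (hκ : ∀ i j, κ i j = κ j i)
    {a : ι → ℂ} {m : ι → ℤ} (hm : ∀ i ∈ s, m i ≠ 0)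
    (hsing : ∀ t : ℂ, ∀ i ∈ s, Complex.sin (a i + t * m i) = 0 → ∀ j ∈ s,
      Complex.sin (a j + t * m j) = 0 → κ i j = 0)
    (hres : ∀ t : ℂ, ∀ i ∈ s, Complex.sin (a i + t * m i) = 0 →
      ∑ j ∈ s, κ i j * Complex.cot (a j + t * m j) = 0)
    (ha : ∀ i ∈ s, Complex.sin (a i) ≠ 0) :
    ∑ i ∈ s, ∑ j ∈ s, κ i j * (Complex.cot (a i) * Complex.cot (a j)) =
      -∑ i ∈ s, ∑ j ∈ s, κ i j * (sgn (m i) * sgn (m j)) := by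
  set F := cotSum s κ a fun i => (m i : ℂ) with hF
  have hm' : ∀ i ∈ s, (m i : ℂ) ≠ 0 := fun i hi => by exact_mod_cast hm i hi
  have hd : ∀ t, (∀ i ∈ s, Complex.sin (a i + t * m i) ≠ 0) → DifferentiableAt ℂ F t :=
    fun t ht => differentiableAt_cotSum κ ht
  have hlim : ∀ t, (∀ i ∈ s, Complex.sin (a i + t * m i) ≠ 0) → limUnder (𝓝[≠] t) F = F t :=
    fun t ht => ((hd t ht).continuousAt.tendsto.mono_left nhdsWithin_le_nhds).limUnder_eq
  have hshift : ∀ t₀ : ℂ, Tendsto (fun t => t - t₀) (𝓝[≠] t₀) (𝓝[≠] 0) := by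
    intro t₀
    refine tendsto_nhdsWithin_iff.2 ⟨?_, ?_⟩
    · have : Continuous fun t : ℂ => t - t₀ := by fun_prop
      simpa using (this.tendsto t₀).mono_left nhdsWithin_le_nhds
    · filter_upwards [self_mem_nhdsWithin] with t ht
      exact sub_ne_zero.2 ht
  have hev : ∀ t₀, ∀ᶠ t in 𝓝[≠] t₀, ∀ i ∈ s, Complex.sin (a i + t * m i) ≠ 0 := by
    intro t₀
    refine (Filter.eventually_all_finset s).2 fun i hi => ?_
    filter_upwards [(hshift t₀).eventually (eventually_sin_line_ne_zero (a i + t₀ * m i) (hm' i hi))]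
      with t ht
    convert ht using 2
    ring
  -- All singularities are removable, so the punctured limits form an entire extension of `F`.
  have hg : Differentiable ℂ fun t => limUnder (𝓝[≠] t) F := by
    refine differentiable_limUnder (fun t₀ => (hev t₀).mono fun t ht => hd t ht) fun t₀ => ?_
    have h1 := (cotSum_isBigO_one hκ (a := fun i => a i + t₀ * m i) hm' (hsing t₀)
      (hres t₀)).comp_tendsto (hshift t₀)
    have h2 : F =O[𝓝[≠] t₀] fun _ => (1 : ℂ) := by
      refine h1.congr_left fun t => ?_
      simp only [Function.comp]
      rw [← cotSum_add, sub_add_cancel]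
    exact (Asymptotics.isBigO_one_iff ℂ).1 h2
  have hFper : ∀ t, F (t + Real.pi) = F t := by
    intro t
    have : ∀ i, Complex.cot (a i + (t + Real.pi) * m i) = Complex.cot (a i + t * m i) := by
      intro i
      rw [← cot_add_int_mul_pi (a i + t * m i) (m i)]
      ring_nf
    simp only [hF, cotSum, this]
  have hper : ∀ t, limUnder (𝓝[≠] (t + (Real.pi : ℂ))) F = limUnder (𝓝[≠] t) F := by
    -- The extension inherits the period from `F` at non-singular points, which accumulate
    -- everywhere; continuity gives the rest.
    have hcl : ∀ t, ∃ᶠ u in 𝓝 t, limUnder (𝓝[≠] (u + (Real.pi : ℂ))) F = limUnder (𝓝[≠] u) F := by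
      intro t
      refine Filter.Frequently.filter_mono (f := 𝓝[≠] t) ?_ nhdsWithin_le_nhds
      refine Filter.Eventually.frequently ?_
      filter_upwards [hev t] with u hu
      rw [hlim u hu, hlim (u + Real.pi) fun i hi => ?_, hFper]
      convert sin_add_int_mul_pi_ne_zero (hu i hi) (m i) using 2
      ring
    intro t
    have hclosed : IsClosed {u | limUnder (𝓝[≠] (u + (Real.pi : ℂ))) F = limUnder (𝓝[≠] u) F} :=
      isClosed_eq (hg.continuous.comp (continuous_add_const _)) hg.continuous
    exact hclosed.mem_of_frequently_of_tendsto (hcl t) tendsto_id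
  have him : ∀ i t, (a i + t * m i).im = (a i).im + t.im * m i := fun i t => by simp
  have hsin : ∀ i ∈ s, ∀ t : ℂ, t.im ≠ -(a i).im / m i → Complex.sin (a i + t * m i) ≠ 0 := by
    intro i hi t ht
    have : (m i : ℝ) ≠ 0 := by exact_mod_cast hm i hi
    refine sin_ne_zero_of_im_ne_zero ?_
    rw [him]
    rw [Ne, eq_div_iff this] at ht
    contrapose! ht
    linarith
  have hFev : ∀ l : Filter ℝ, (∀ x, ∀ᶠ y in l, y ≠ x) →
      ∀ᶠ t in comap Complex.im l, F t = limUnder (𝓝[≠] t) F := by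
    intro l hl
    have : ∀ᶠ t in comap Complex.im l, ∀ i ∈ s, t.im ≠ -(a i).im / m i :=
      (Filter.eventually_all_finset s).2 fun i _ => tendsto_comap.eventually (hl _)
    filter_upwards [this] with t ht
    exact (hlim t fun i hi => hsin i hi t (ht i hi)).symm
  have h₁ : Tendsto F (comap Complex.im atTop)
      (𝓝 (-∑ i ∈ s, ∑ j ∈ s, κ i j * (sgn (m i) * sgn (m j)))) :=
    tendsto_sum_cot_mul_cot s κ fun i hi => tendsto_cot_of_im_add_mul tendsto_comap
      (by exact_mod_cast hm i hi) (him i)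
  -- The parameter `-Im t` with slopes `-m i` reduces `-i∞` to the same lemma. Only the existence of
  -- this limit matters.
  have h₂ : Tendsto F (comap Complex.im atBot)
      (𝓝 (-∑ i ∈ s, ∑ j ∈ s, κ i j * (sgn (-m i) * sgn (-m j)))) :=
    tendsto_sum_cot_mul_cot s κ fun i hi => tendsto_cot_of_im_add_mul
      (τ := fun t : ℂ => -t.im) (tendsto_neg_atBot_atTop.comp tendsto_comap)
      (by simpa using hm i hi) (fun t => by rw [him]; ring)
  have key := eq_of_periodic_of_tendsto hg hper (h₁.congr' (hFev _ fun x => eventually_ne_atTop x))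
    (h₂.congr' (hFev _ fun x => eventually_ne_atBot x)) 0
  rw [hlim 0 (by simpa using ha)] at key
  simpa [hF, cotSum] using key

end

/-! ### The WDVV equations as constancy of a cotangent sum, and its value at infinity. -/

section

variable {V : Type*} [AddCommGroup V] [Module ℂ V]

/-- Each `Re (f i)` is a non-zero real functional, since `f i` takes the value 1; finitely many such
functionals have a common point of non-vanishing. -/
lemma exists_forall_re_ne_zero {ι : Type*} [Finite ι] (f : ι → Module.Dual ℂ V)
    (h : ∀ i, f i ≠ 0) : ∃ v, ∀ i, (f i v).re ≠ 0 := by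
  let _ : Module ℝ V := Module.complexToReal V
  refine Module.Dual.exists_forall_ne_zero_of_forall_exists (K := ℝ)
    (fun i => Complex.reLm ∘ₗ (f i).restrictScalars ℝ) fun i => ?_
  obtain ⟨x, hx⟩ := DFunLike.ne_iff.1 (h i)
  refine ⟨(f i x)⁻¹ • x, ?_⟩
  have hx' : f i x ≠ 0 := by simpa using hx
  simp [hx']

/-- The sum `∑ κ(α, β) cot(α(x)) cot(β(x))`. -/
def cotPair (A : Finset (Module.Dual ℂ V)) (κ : Module.Dual ℂ V → Module.Dual ℂ V → ℂ) (x : V) :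
    ℂ :=
  ∑ α ∈ A, ∑ β ∈ A, κ α β * (Complex.cot (α x) * Complex.cot (β x))

/-- An identity for `cotPair` that holds at generic points of a line holds at each of its
non-singular points. -/
lemma cotPair_eq_of_generic {A : Finset (Module.Dual ℂ V)}
    {κ : Module.Dual ℂ V → Module.Dual ℂ V → ℂ} {C : ℂ} {x u : V}
    (hx : ∀ α ∈ A, Complex.sin (α x) ≠ 0) {J : Type*} [Countable J] {a b : J → ℂ}
    (hb : ∀ j, b j ≠ 0)
    (h : ∀ s : ℝ, (∀ α ∈ A, Complex.sin (α (x + (s : ℂ) • u)) ≠ 0) → (∀ j, a j + s * b j ≠ 0) →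
      cotPair A κ (x + (s : ℂ) • u) = C) : cotPair A κ x = C := by
  -- Each condition excludes at most one real `s`, so the admissible `s` are dense near 0.
  have hcount : (⋃ j, {s : ℝ | a j + s * b j = 0}).Countable := by
    refine Set.countable_iUnion fun j => Set.Subsingleton.countable fun s hs s' hs' => ?_
    have : ((s : ℂ) - s') * b j = 0 := by
      rw [mem_ofPred_eq] at hs hs'
      linear_combination hs - hs'
    exact_mod_cast sub_eq_zero.1 ((mul_eq_zero.1 this).resolve_right (hb j))
  have hfreq := mem_closure_iff_frequently.1 (hcount.dense_compl ℝ (0 : ℝ))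
  have hsin : ∀ᶠ s : ℝ in 𝓝 0, ∀ α ∈ A, Complex.sin (α (x + (s : ℂ) • u)) ≠ 0 := by
    refine (Filter.eventually_all_finset A).2 fun α hα => ?_
    have : Continuous fun s : ℝ => Complex.sin (α (x + (s : ℂ) • u)) := by
      simp only [map_add, map_smul, smul_eq_mul]
      fun_prop
    exact this.continuousAt.eventually_ne (by simpa using hx α hα)
  have hcot : ∀ α ∈ A, ContinuousAt (fun s : ℝ => Complex.cot (α (x + (s : ℂ) • u))) 0 := by
    intro α hα
    have := (differentiableAt_cot_line (a := α x) (α u) (0 : ℂ) (by simpa using hx α hα)).continuousAt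
    have h2 := ContinuousAt.comp (f := fun s : ℝ => (s : ℂ)) (x := 0) (by simpa using this)
      Complex.continuous_ofReal.continuousAt
    simpa [Function.comp_def] using h2
  have hcont : ContinuousAt (fun s : ℝ => cotPair A κ (x + (s : ℂ) • u)) 0 :=
    tendsto_finsetSum A fun α hα => tendsto_finsetSum A fun β hβ =>
      ((hcot α hα).mul (hcot β hβ)).const_mul (κ α β)
  have := (isClosed_singleton (x := C)).mem_of_frequently_of_tendsto
      ((hfreq.and_eventually hsin).mono fun s hs => mem_singleton_iff.2
        (h s hs.2 fun j hj => hs.1 (mem_iUnion.2 ⟨j, hj⟩))) hcont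
  simpa using this

lemma mem_trigDomain_of_re {z : ℂ} (h : ∀ k : ℤ, (z.re : ℂ) - k * Real.pi / 2 ≠ 0) :
    z ∈ trigDomain := by
  refine Or.inr fun h0 => ?_
  have h1 : (1 - Complex.exp (-2 * Complex.I * z)).im = Real.exp (2 * z.im) * Real.sin (2 * z.re) := by
    simp [Complex.exp_im]
  rw [h1, mul_eq_zero, or_iff_right (Real.exp_pos _).ne', Real.sin_eq_zero_iff] at h0
  obtain ⟨k, hk⟩ := h0
  apply h k
  have : ((k * Real.pi : ℝ) : ℂ) = (2 * z.re : ℝ) := by rw [hk]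
  push_cast at this
  linear_combination -this / 2

/-- The branch cuts of the trilogarithm leave no trace in the cotangents: they are avoided by a
dense set of shifts along `u`, and `cot` is continuous across them. -/
lemma cotPair_eq_of_holDomain {A : Finset (Module.Dual ℂ V)} (h0 : (0 : Module.Dual ℂ V) ∉ A)
    {κ : Module.Dual ℂ V → Module.Dual ℂ V → ℂ} {C : ℂ}
    (h : ∀ P ∈ holDomain A, cotPair A κ P.1 = C) {x : V}
    (hx : ∀ α ∈ A, Complex.sin (α x) ≠ 0) : cotPair A κ x = C := by
  obtain ⟨u, hu⟩ := exists_forall_re_ne_zero (fun α : A => (α : Module.Dual ℂ V))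
    fun α hα => h0 (hα ▸ α.2)
  refine cotPair_eq_of_generic (u := u) hx (J := A × ℤ)
    (a := fun j => ((j.1.1 x).re : ℂ) - j.2 * Real.pi / 2) (b := fun j => ((j.1.1 u).re : ℂ))
    (fun j => by exact_mod_cast hu j.1) fun s _ hs => ?_
  refine h (x + (s : ℂ) • u, 0) fun α hα => mem_trigDomain_of_re fun k => ?_
  convert hs (⟨α, hα⟩, k) using 1
  simp
  ring

lemma makePos_eq (v : V) (α : Module.Dual ℂ V) : makePos v α = sgn (α v).re • α := by
  rw [makePos, sgn]
  split_ifs <;> simp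

variable [FiniteDimensional ℂ V]

/-- The coefficients `c_α c_β (α, β) B_{α,β}(z) B_{α,β}(w)`. -/
def veeKernel {A : Finset (Module.Dual ℂ V)} {c : Module.Dual ℂ V → ℂ}
    (hG : (formG A c).Nondegenerate) (z w : V ⊗[ℂ] V) (α β : Module.Dual ℂ V) : ℂ :=
  c α * c β * formG A c (vee hG α) (vee hG β) * (formB α β z * formB α β w)

lemma veeKernel_comm {A : Finset (Module.Dual ℂ V)} {c : Module.Dual ℂ V → ℂ}
    (hG : (formG A c).Nondegenerate) (z w : V ⊗[ℂ] V) (α β : Module.Dual ℂ V) :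
    veeKernel hG z w α β = veeKernel hG z w β α := by
  rw [veeKernel, veeKernel, formG_comm, formB_swap β α z, formB_swap β α w]
  ring

/-- The WDVV equations as the condition that a cotangent sum is constant. -/
lemma wdvvOn_iff_cotPair {N : ℕ} (b : Module.Basis (Fin N) ℂ V)
    {A : Finset (Module.Dual ℂ V)} {c : Module.Dual ℂ V → ℂ} (hG : (formG A c).Nondegenerate)
    {lam : ℂ} (hl : lam ≠ 0) (h0 : (0 : Module.Dual ℂ V) ∉ A) :
    WDVVOn b (prepotential A c lam) (holDomain A) ↔
      ∀ x, (∀ α ∈ A, Complex.sin (α x) ≠ 0) → ∀ z w : altSquare V,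
        formG1 A c z w + lam ^ 2 / 4 * cotPair A (veeKernel hG z w) x = 0 := by
  have e1 : ∀ z w : altSquare V, formG1 A c z w = pairForm A (fun α β => c α * c β) z w :=
    fun z w => rfl
  have e2 : ∀ x (z w : V ⊗[ℂ] V), pairForm A (fun α β => c α * c β *
      formG A c (vee hG α) (vee hG β) * (Complex.cot (α x) * Complex.cot (β x))) z w =
      cotPair A (veeKernel hG z w) x := by
    intro x z w
    rw [pairForm_apply]
    refine Finset.sum_congr rfl fun α _ => Finset.sum_congr rfl fun β _ => ?_
    rw [veeKernel]; ring
  rw [wdvvOn_iff b hG]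
  simp only [e1, e2]
  constructor
  · intro h x hx z w
    have hl2 : lam ^ 2 / 4 ≠ 0 := div_ne_zero (pow_ne_zero _ hl) (by norm_num)
    rw [cotPair_eq_of_holDomain h0 (C := -(pairForm A (fun α β => c α * c β) z w) / (lam ^ 2 / 4))
      (fun P hP => ?_) hx]
    · field_simp; ring
    · rw [eq_div_iff hl2]
      linear_combination h P hP z z.2 w w.2
  · intro h P hP z hz w hw
    exact h P.1 (fun α hα => sin_ne_zero_of_mem_trigDomain (hP α hα)) ⟨z, hz⟩ ⟨w, hw⟩

/-- The forms `B_{α,β}` occur twice and do not see signs, while `G(α^∨, β^∨)` picks up both. Merging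
multiplicities is summation over the fibres of `makePos v`. -/
lemma formG2_apply {A : Finset (Module.Dual ℂ V)} {c : Module.Dual ℂ V → ℂ}
    (hG : (formG A c).Nondegenerate) (v : V) (z w : altSquare V) :
    formG2 hG v z w =
      ∑ α ∈ A, ∑ β ∈ A, veeKernel hG z w α β * (sgn (α v).re * sgn (β v).re) := by
  classical
  have hsum : ∀ f : Module.Dual ℂ V → ℂ, ∑ α ∈ posSystem A v, posMult A c v α * f α =
      ∑ α ∈ A, c α * f (makePos v α) := by
    intro f
    rw [← Finset.sum_fiberwise_of_maps_to (t := posSystem A v) (g := makePos v) fun α hα =>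
      Finset.mem_image_of_mem _ hα]
    refine Finset.sum_congr rfl fun β _ => ?_
    rw [posMult, Finset.sum_mul]
    refine Finset.sum_congr (by congr) fun α hα => ?_
    rw [(Finset.mem_filter.1 hα).2]
  have h1 : formG2 hG v z w = ∑ α ∈ posSystem A v, posMult A c v α *
      ∑ β ∈ posSystem A v, posMult A c v β * (formG A c (vee hG α) (vee hG β) *
        (formB α β z * formB α β w)) := by
    simp only [formG2, LinearMap.BilinForm.restrict_apply, LinearMap.domRestrict_apply,
      LinearMap.sum_apply, LinearMap.smul_apply, LinearMap.BilinForm.linMulLin_apply, smul_eq_mul,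
      Finset.mul_sum]
    exact Finset.sum_congr rfl fun α _ => Finset.sum_congr rfl fun β _ => by ring
  have hs : ∀ r : ℝ, sgn r ^ 2 = 1 := fun r => by rw [sgn]; split_ifs <;> norm_num
  rw [h1, hsum]
  refine Finset.sum_congr rfl fun α _ => ?_
  rw [hsum, Finset.mul_sum]
  refine Finset.sum_congr rfl fun β _ => ?_
  have hv : ∀ (k : ℂ) (γ : Module.Dual ℂ V), vee hG (k • γ) = k • vee hG γ := fun k γ => by
    simp [vee]
  simp only [makePos_eq, hv, formB_smul_left, formB_smul_right, veeKernel, map_smul,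
    LinearMap.smul_apply, smul_eq_mul]
  linear_combination (c α * c β * sgn (α v).re * sgn (β v).re *
    formG A c (vee hG α) (vee hG β) * formB α β z * formB α β w) *
      (sgn (β v).re ^ 2 * hs (α v).re + hs (β v).re)

/-- The limit of the WDVV equations at infinity. -/
lemma formG1_eq_of_wdvv {A : Finset (Module.Dual ℂ V)} {c : Module.Dual ℂ V → ℂ}
    (hG : (formG A c).Nondegenerate) (lam : ℂ)
    (h : ∀ x, (∀ α ∈ A, Complex.sin (α x) ≠ 0) → ∀ z w : altSquare V,
        formG1 A c z w + lam ^ 2 / 4 * cotPair A (veeKernel hG z w) x = 0)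
    {v : V} (hv : IsRegular A v) : formG1 A c = (lam ^ 2 / 4) • formG2 hG v := by
  ext z w
  have him : ∀ (α : Module.Dual ℂ V) (t : ℝ), (α ((Complex.I * t) • v)).im = 0 + t * (α v).re :=
    fun α t => by simp
  have hlim : Tendsto (fun t : ℝ => cotPair A (veeKernel hG z w) ((Complex.I * t) • v)) atTop
      (𝓝 (-formG2 hG v z w)) := by
    rw [formG2_apply]
    exact tendsto_sum_cot_mul_cot A _ fun α hα =>
      tendsto_cot_of_im_add_mul tendsto_id (hv α hα) (him α)
  have h2 := (hlim.const_mul (lam ^ 2 / 4)).const_add (formG1 A c z w)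
  have h3 : ∀ᶠ t : ℝ in atTop, formG1 A c z w +
      lam ^ 2 / 4 * cotPair A (veeKernel hG z w) ((Complex.I * t) • v) = 0 := by
    filter_upwards [eventually_gt_atTop 0] with t ht
    refine h _ (fun α hα => sin_ne_zero_of_im_ne_zero ?_) z w
    rw [him, zero_add]
    exact mul_ne_zero ht.ne' (hv α hα)
  have h4 := tendsto_nhds_unique (h2.congr' h3) tendsto_const_nhds
  simp only [LinearMap.smul_apply, smul_eq_mul]
  linear_combination h4

end

/-! ### The `α`-series, and WDVV from the `∨`-conditions. -/

section

variable {V : Type*} [AddCommGroup V] [Module ℂ V]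

/-- Equality up to sign and integer multiples of `α`. -/
def seriesSetoid (α : Module.Dual ℂ V) : Setoid (Module.Dual ℂ V) where
  r β γ := ∃ m : ℤ, γ = β + m • α ∨ γ = -β + m • α
  iseqv := by
    refine ⟨fun β => ⟨0, by simp⟩, ?_, ?_⟩
    · rintro β γ ⟨m, rfl | rfl⟩
      · exact ⟨-m, Or.inl (by module)⟩
      · exact ⟨m, Or.inr (by module)⟩
    · rintro β γ δ ⟨m, rfl | rfl⟩ ⟨n, rfl | rfl⟩
      · exact ⟨m + n, Or.inl (by module)⟩
      · exact ⟨n - m, Or.inr (by module)⟩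
      · exact ⟨m + n, Or.inr (by module)⟩
      · exact ⟨n - m, Or.inl (by module)⟩

lemma mem_collinearSet {A : Finset (Module.Dual ℂ V)} {α γ : Module.Dual ℂ V} :
    γ ∈ collinearSet A α ↔ γ ∈ A ∧ ∃ k : ℂ, γ = k • α := by
  classical
  simp [collinearSet]

open Classical in
/-- The `α`-series of `β`. -/
def seriesOf (A : Finset (Module.Dual ℂ V)) (α β : Module.Dual ℂ V) :
    Finset (Module.Dual ℂ V) :=
  A.filter fun γ => seriesSetoid α γ β

lemma mem_seriesOf {A : Finset (Module.Dual ℂ V)} {α β γ : Module.Dual ℂ V} :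
    γ ∈ seriesOf A α β ↔ γ ∈ A ∧ ∃ m : ℤ, γ = β + m • α ∨ γ = -β + m • α := by
  classical
  rw [seriesOf, Finset.mem_filter]
  exact and_congr_right fun _ => ⟨fun h => (seriesSetoid α).symm h, fun h => (seriesSetoid α).symm h⟩

lemma collinear_of_seriesSetoid {α β γ : Module.Dual ℂ V} (h : seriesSetoid α β γ)
    (hγ : ∃ k : ℂ, γ = k • α) : ∃ k : ℂ, β = k • α := by
  obtain ⟨k, rfl⟩ := hγ
  obtain ⟨m, rfl | rfl⟩ := (seriesSetoid α).symm h
  · exact ⟨k + m, by module⟩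
  · exact ⟨-k + m, by module⟩

lemma isSeries_seriesOf {A : Finset (Module.Dual ℂ V)} {α β : Module.Dual ℂ V} (hβ : β ∈ A)
    (hαβ : β ∉ collinearSet A α) : IsSeries A α (seriesOf A α β) where
  subset := fun γ hγ => (mem_seriesOf.1 hγ).1
  not_collinear := fun γ hγ h => hαβ (mem_collinearSet.2
    ⟨hβ, collinear_of_seriesSetoid (mem_seriesOf.1 hγ).2 (mem_collinearSet.1 h).2⟩)
  nonempty := ⟨β, mem_seriesOf.2 ⟨hβ, 0, by simp⟩⟩
  related := fun γ₁ h₁ γ₂ h₂ => by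
    obtain ⟨m, h⟩ := (seriesSetoid α).trans ((seriesSetoid α).symm (mem_seriesOf.1 h₂).2)
      (mem_seriesOf.1 h₁).2
    refine ⟨m, ?_⟩
    rcases h with rfl | rfl
    · exact Or.inr (by module)
    · exact Or.inl (by module)
  maximal := fun γ hγ δ hδ m h =>
    mem_seriesOf.2 ⟨hδ, (seriesSetoid α).trans (mem_seriesOf.1 hγ).2 ⟨m, h⟩⟩

lemma formB_add_zsmul (α β : Module.Dual ℂ V) (m : ℤ) : formB α (β + m • α) = formB α β := by
  rw [formB_add_right, ← Int.cast_smul_eq_zsmul ℂ, formB_smul_right, formB_self, smul_zero,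
    add_zero]

/-- Adding `m α` changes neither `B_{α,β}` nor, as `α(x) ∈ πℤ`, the cotangent; replacing `β` by `-β`
changes the sign of both. -/
lemma formB_mul_cot_of_series {α β γ : Module.Dual ℂ V} {x : V} (hx : Complex.sin (α x) = 0)
    (h : ∃ m : ℤ, γ = β + m • α ∨ γ = -β + m • α) (w : V ⊗[ℂ] V) :
    formB α γ w * Complex.cot (γ x) = formB α β w * Complex.cot (β x) := by
  obtain ⟨k, hk⟩ := Complex.sin_eq_zero_iff.1 hx
  have hneg : formB α (-β) = -formB α β := by
    simpa using formB_smul_right α β (-1)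
  have hm : ∀ (m : ℤ) (δ : Module.Dual ℂ V),
      Complex.cot ((δ + m • α) x) = Complex.cot (δ x) := by
    intro m δ
    rw [← cot_add_int_mul_pi (δ x) (m * k)]
    simp [hk, mul_assoc]
  obtain ⟨m, rfl | rfl⟩ := h
  · rw [formB_add_zsmul, hm]
  · rw [formB_add_zsmul, hm, hneg]
    simp [cot_neg]

lemma tendsto_intFloor_mul_div (y : ℝ) :
    Tendsto (fun D : ℕ => (⌊D * y⌋ : ℝ) / D) atTop (𝓝 y) := by
  have h1 : Tendsto (fun D : ℕ => y - 1 / (D : ℝ)) atTop (𝓝 y) := by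
    simpa using (tendsto_one_div_atTop_nhds_zero_nat (𝕜 := ℝ)).const_sub y
  refine tendsto_of_tendsto_of_tendsto_of_le_of_le' h1 tendsto_const_nhds ?_ ?_
  · filter_upwards [eventually_gt_atTop 0] with D hD
    have hD : (0 : ℝ) < D := by exact_mod_cast hD
    rw [le_div_iff₀ hD, sub_mul, one_div_mul_cancel hD.ne', mul_comm y]
    exact (Int.sub_one_lt_floor _).le
  · filter_upwards [eventually_gt_atTop 0] with D hD
    have hD : (0 : ℝ) < D := by exact_mod_cast hD
    rw [div_le_iff₀ hD, mul_comm y]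
    exact Int.floor_le _

variable [FiniteDimensional ℂ V]

lemma sum_series_formB {A : Finset (Module.Dual ℂ V)} {c : Module.Dual ℂ V → ℂ}
    {hG : (formG A c).Nondegenerate} (hvee : IsTrigVeeSystem hG) {α : Module.Dual ℂ V}
    (hα : α ∈ A) {Γ : Finset (Module.Dual ℂ V)} (hΓ : IsSeries A α Γ) (z : V ⊗[ℂ] V) :
    ∑ β ∈ Γ, c β * α (vee hG β) * formB α β z = 0 := by
  have := congrArg (fun T => TensorProduct.dualDistrib ℂ V V T z) (hvee α hα Γ hΓ)
  simpa [formB] using this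

/-- The vanishing of residues. One factor `B_{α,β}(w) cot β(x)` is constant along each series and
can be taken out, which leaves the `∨`-condition; collinear covectors contribute nothing as
`B_{α,kα} = 0`. -/
lemma sum_veeKernel_mul_cot {A : Finset (Module.Dual ℂ V)} {c : Module.Dual ℂ V → ℂ}
    {hG : (formG A c).Nondegenerate} (hvee : IsTrigVeeSystem hG) (z w : V ⊗[ℂ] V)
    {α : Module.Dual ℂ V} (hα : α ∈ A) {x : V} (hx : Complex.sin (α x) = 0) :
    ∑ β ∈ A, veeKernel hG z w α β * Complex.cot (β x) = 0 := by
  classical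
  rw [← Finset.sum_filter_add_sum_filter_not A (fun β => β ∈ collinearSet A α)]
  have h1 : ∑ β ∈ A with β ∈ collinearSet A α, veeKernel hG z w α β * Complex.cot (β x) = 0 := by
    refine Finset.sum_eq_zero fun β hβ => ?_
    obtain ⟨k, rfl⟩ := (mem_collinearSet.1 (Finset.mem_filter.1 hβ).2).2
    simp [veeKernel, formB_smul_right, formB_self]
  rw [h1, zero_add]
  refine Finset.sum_cancels_of_partition_cancels (seriesSetoid α) fun β hβ => ?_
  obtain ⟨hβA, hβ⟩ := Finset.mem_filter.1 hβ
  have hΓ : (A.filter fun γ => γ ∉ collinearSet A α).filter (fun γ => seriesSetoid α γ β) =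
      seriesOf A α β := by
    ext γ
    rw [seriesOf, Finset.mem_filter, Finset.mem_filter, Finset.mem_filter]
    refine ⟨fun h => ⟨h.1.1, h.2⟩, fun h => ⟨⟨h.1, fun hγ => hβ ?_⟩, h.2⟩⟩
    exact mem_collinearSet.2 ⟨hβA, collinear_of_seriesSetoid ((seriesSetoid α).symm h.2)
      (mem_collinearSet.1 hγ).2⟩
  rw [hΓ]
  have h2 := sum_series_formB hvee hα (isSeries_seriesOf hβA hβ) z
  calc _ = ∑ γ ∈ seriesOf A α β, c γ * α (vee hG γ) * formB α γ z *
        (c α * (formB α β w * Complex.cot (β x))) := by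
        refine Finset.sum_congr rfl fun γ hγ => ?_
        rw [← formB_mul_cot_of_series hx (mem_seriesOf.1 hγ).2, veeKernel, formG_vee]
        ring
    _ = 0 := by rw [← Finset.sum_mul, h2, zero_mul]

/-- A positive system of covectors in a lattice is given by a vector with integer values. -/
lemma exists_int_values {A : Finset (Module.Dual ℂ V)} (hA : InLattice A) {v : V}
    (hv : IsRegular A v) : ∃ (v' : V) (m : Module.Dual ℂ V → ℤ),
      (∀ α ∈ A, α v' = m α) ∧ ∀ α ∈ A, m α ≠ 0 ∧ sgn (m α) = sgn (α v).re := by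
  obtain ⟨e, he⟩ := hA
  have hcoef : ∀ α : Module.Dual ℂ V, ∃ k : Fin (Module.finrank ℂ V) → ℤ,
      α ∈ A → α = ∑ i, k i • e i := by
    intro α
    by_cases hα : α ∈ A
    · obtain ⟨k, hk⟩ := (Submodule.mem_span_range_iff_exists_fun ℤ).1 (he α hα)
      exact ⟨k, fun _ => hk.symm⟩
    · exact ⟨0, fun h => absurd h hα⟩
  choose k hk using hcoef
  have hre : ∀ α ∈ A, (α v).re = ∑ i, (k α i : ℝ) * (e i v).re := by
    intro α hα
    conv_lhs => rw [hk α hα]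
    simp [LinearMap.sum_apply]
  -- The numbers `Re e_i(v)` are approximated by fractions with denominator `D`. For large `D` every
  -- `α ∈ A` keeps its sign, and clearing `D` makes the values integers.
  have hlim : ∀ α ∈ A, Tendsto (fun D : ℕ => ∑ i, (k α i : ℝ) * (⌊D * (e i v).re⌋ / (D : ℝ)))
      atTop (𝓝 (α v).re) := by
    intro α hα
    rw [hre α hα]
    refine tendsto_finsetSum _ fun i _ => Tendsto.const_mul _ ?_
    exact tendsto_intFloor_mul_div _
  have hev : ∀ᶠ D : ℕ in atTop, ∀ α ∈ A,
      0 < (∑ i, (k α i : ℝ) * (⌊D * (e i v).re⌋ / (D : ℝ))) * (α v).re := by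
    refine (Filter.eventually_all_finset A).2 fun α hα => ?_
    have h1 := (hlim α hα).mul_const (α v).re
    exact h1.eventually_const_lt (mul_self_pos.2 (hv α hα))
  obtain ⟨D, hD, hD0⟩ := (hev.and (eventually_gt_atTop 0)).exists
  have hD0 : (0 : ℝ) < D := by exact_mod_cast hD0
  set y : Fin (Module.finrank ℂ V) → ℤ := fun i => ⌊D * (e i v).re⌋
  refine ⟨(Module.evalEquiv ℂ V).symm (e.constr ℂ fun i => (y i : ℂ)),
    fun α => ∑ i, k α i * y i, fun α hα => ?_, fun α hα => ?_⟩
  · have : ∀ β : Module.Dual ℂ V, β ((Module.evalEquiv ℂ V).symm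
        (e.constr ℂ fun i => (y i : ℂ))) = e.constr ℂ (fun i => (y i : ℂ)) β := by
      intro β
      rw [Module.apply_evalEquiv_symm_apply]
    rw [this]
    conv_lhs => rw [hk α hα]
    simp only [map_sum, map_zsmul, Module.Basis.constr_basis]
    simp
  · have h1 := hD α hα
    have h2 : (∑ i, (k α i : ℝ) * (⌊D * (e i v).re⌋ / (D : ℝ))) =
        ((∑ i, k α i * y i : ℤ) : ℝ) / D := by
      push_cast
      rw [Finset.sum_div]
      exact Finset.sum_congr rfl fun i _ => by rw [mul_div_assoc]
    rw [h2, div_mul_eq_mul_div] at h1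
    have h3 := (div_pos_iff_of_pos_right hD0).1 h1
    refine ⟨fun h => by simp [h] at h3, ?_⟩
    rw [sgn, sgn]
    rcases pos_and_pos_or_neg_and_neg_of_mul_pos h3 with h | h
    · rw [if_pos h.1, if_pos h.2]
    · rw [if_neg h.1.not_gt, if_neg h.2.not_gt]

/-- For a trigonometric `∨`-system the cotangent sum is constant. -/
lemma cotPair_eq_of_isTrigVeeSystem {A : Finset (Module.Dual ℂ V)} {c : Module.Dual ℂ V → ℂ}
    (hA : InLattice A)
    {hG : (formG A c).Nondegenerate} (hvee : IsTrigVeeSystem hG) {v : V} (hv : IsRegular A v)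
    (z w : altSquare V) {x : V} (hx : ∀ α ∈ A, Complex.sin (α x) ≠ 0) :
    cotPair A (veeKernel hG z w) x = -formG2 hG v z w := by
  obtain ⟨v', m, hm, hm'⟩ := exists_int_values hA hv
  -- If non-collinear `α, β` are both singular at `X + t v'`, eliminating `t` puts `(m_β α - m_α
  -- β)(X)` in a countable set. This functional is non-zero, so a generic shift along `u` prevents
  -- it; then only collinear covectors are singular together, and the kernel vanishes on them.
  let K := {p : A × A // ¬ ∃ k : ℂ, (p.2 : Module.Dual ℂ V) = k • (p.1 : Module.Dual ℂ V)}
  let f : K → Module.Dual ℂ V := fun p => (m p.1.2 : ℂ) • p.1.1.1 - (m p.1.1 : ℂ) • p.1.2.1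
  have hm0 : ∀ α ∈ A, (m α : ℂ) ≠ 0 := fun α hα => by exact_mod_cast (hm' α hα).1
  obtain ⟨u, hu⟩ := exists_forall_re_ne_zero f fun p hp => by
    refine p.2 ⟨(m p.1.1 : ℂ)⁻¹ * m p.1.2, ?_⟩
    rw [mul_smul, eq_inv_smul_iff₀ (hm0 _ p.1.1.2)]
    exact (sub_eq_zero.1 hp).symm
  refine cotPair_eq_of_generic (u := u) hx (J := K × ℤ × ℤ)
    (a := fun j => f j.1 x - Real.pi * (m j.1.1.2 * j.2.1 - m j.1.1.1 * j.2.2))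
    (b := fun j => f j.1 u) (fun j h => hu j.1 (by simp [h])) fun s hs hgen => ?_
  set X := x + (s : ℂ) • u with hX
  have hline : ∀ t : ℂ, ∀ α ∈ A, α X + t * m α = α (X + t • v') := fun t α hα => by
    simp [hm α hα]
  have key := cotSum_eq_of_residues (s := A) (κ := veeKernel hG z w) (veeKernel_comm hG z w)
    (a := fun α => α X) (m := m) (fun α hα => (hm' α hα).1) ?_ ?_ hs
  · rw [cotPair, key, formG2_apply]
    congr 1
    refine Finset.sum_congr rfl fun α hα => Finset.sum_congr rfl fun β hβ => ?_
    rw [(hm' α hα).2, (hm' β hβ).2]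
  · intro t α hα h1 β hβ h2
    by_cases hk : ∃ k : ℂ, β = k • α
    · obtain ⟨k, rfl⟩ := hk
      simp [veeKernel, formB_smul_right, formB_self]
    · exfalso
      obtain ⟨k, hk1⟩ := Complex.sin_eq_zero_iff.1 h1
      obtain ⟨l, hl1⟩ := Complex.sin_eq_zero_iff.1 h2
      refine hgen (⟨(⟨α, hα⟩, ⟨β, hβ⟩), hk⟩, k, l) ?_
      simp only [hX, map_add, map_smul, smul_eq_mul] at hk1 hl1
      simp only [f, LinearMap.sub_apply, LinearMap.smul_apply, smul_eq_mul]
      linear_combination (m β : ℂ) * hk1 - (m α : ℂ) * hl1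
  · intro t α hα h1
    rw [hline t α hα] at h1
    rw [← sum_veeKernel_mul_cot hvee (z : V ⊗[ℂ] V) w hα h1]
    exact Finset.sum_congr rfl fun β hβ => by rw [hline t β hβ]

end

/-! ### Separating exponentials with different decay or different phase. -/

/-- Weights with vanishing power sums cancel at each node. -/
lemma sum_filter_eq_zero_of_pow_sums {ι : Type*} {s : Finset ι} {g μ : ι → ℂ}
    (h : ∀ k : ℕ, ∑ i ∈ s, g i * μ i ^ k = 0) (j : ι) : ∑ i ∈ s with μ i = μ j, g i = 0 := by
  classical
  have hp : ∀ p : Polynomial ℂ, ∑ i ∈ s, g i * p.eval (μ i) = 0 := by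
    intro p
    simp only [Polynomial.eval_eq_sum_range, Finset.mul_sum]
    rw [Finset.sum_comm]
    refine Finset.sum_eq_zero fun k _ => ?_
    have := congrArg (p.coeff k * ·) (h k)
    simp only [Finset.mul_sum, mul_zero] at this
    rw [← this]
    exact Finset.sum_congr rfl fun i _ => by ring
  -- A polynomial vanishing at all nodes other than `μ j`.
  set p : Polynomial ℂ := ∏ x ∈ (s.image μ).erase (μ j), (Polynomial.X - Polynomial.C x) with hpdef
  have hne : p.eval (μ j) ≠ 0 := by
    rw [hpdef, Polynomial.eval_prod, Finset.prod_ne_zero_iff]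
    intro x hx
    simpa [sub_eq_zero] using (Finset.ne_of_mem_erase hx).symm
  have hz : ∀ i ∈ s, μ i ≠ μ j → p.eval (μ i) = 0 := by
    intro i hi hij
    rw [hpdef, Polynomial.eval_prod]
    exact Finset.prod_eq_zero (Finset.mem_erase.2 ⟨hij, Finset.mem_image_of_mem _ hi⟩) (by simp)
  have h1 := hp p
  rw [← Finset.sum_filter_add_sum_filter_not s fun i => μ i = μ j,
    Finset.sum_eq_zero (s := s.filter fun i => ¬ μ i = μ j) fun i hi => by
      rw [hz i (Finset.mem_filter.1 hi).1 (Finset.mem_filter.1 hi).2, mul_zero], add_zero,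
    Finset.sum_congr rfl fun i hi => by rw [(Finset.mem_filter.1 hi).2], ← Finset.sum_mul] at h1
  exact (mul_eq_zero.1 h1).resolve_right hne

lemma tendsto_exp_neg_mul {ρ : ℂ} (hρ : 0 < ρ.re) :
    Tendsto (fun t : ℝ => Complex.exp (-2 * t * ρ)) atTop (𝓝 0) := by
  refine Complex.tendsto_exp_comap_re_atBot.comp (tendsto_comap_iff.2 ?_)
  have : Complex.re ∘ (fun t : ℝ => -2 * (t : ℂ) * ρ) = fun t : ℝ => t * (-2 * ρ.re) := by
    ext t; simp; ring
  rw [this]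
  exact tendsto_id.atTop_mul_const_of_neg (by linarith)

/-- The leading asymptotic term of a linear relation between cotangents. -/
lemma sum_leading_eq_zero {ι : Type*} {s : Finset ι} {w θ ρ : ι → ℂ} (hρ : ∀ i ∈ s, 0 < (ρ i).re)
    {ρ₀ : ℂ} (hρ₀ : ∀ i ∈ s, ρ i = ρ₀ ∨ ρ₀.re < (ρ i).re)
    (h : ∀ᶠ t : ℝ in atTop, ∑ i ∈ s, w i * Complex.cot (θ i + Complex.I * t * ρ i) = 0) :
    ∑ i ∈ s with ρ i = ρ₀, w i * Complex.exp (2 * Complex.I * θ i) = 0 := by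
  have him : ∀ i, ∀ t : ℝ, (θ i + Complex.I * t * ρ i).im = (θ i).im + t * (ρ i).re :=
    fun i t => by simp
  have hsum : ∑ i ∈ s, w i = 0 := by
    have h1 := tendsto_finsetSum s fun i hi => (tendsto_cot_of_im_add_mul tendsto_id
      (hρ i hi).ne' (him i)).const_mul (w i)
    have h2 := tendsto_nhds_unique (h1.congr' h) tendsto_const_nhds
    rw [Finset.sum_congr rfl fun i hi => by rw [sgn, if_pos (hρ i hi), mul_one],
      ← Finset.sum_mul] at h2
    exact (mul_eq_zero.1 h2).resolve_right (neg_ne_zero.2 Complex.I_ne_zero)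
  set q : ι → ℝ → ℂ := fun i t => Complex.exp (2 * Complex.I * (θ i + Complex.I * t * ρ i)) with hq
  have hqe : ∀ i t, q i t = Complex.exp (2 * Complex.I * θ i) * Complex.exp (-2 * t * ρ i) := by
    intro i t
    simp only [hq]
    rw [← Complex.exp_add]
    congr 1
    linear_combination (2 * t * ρ i) * Complex.I_sq
  have hq0 : ∀ i ∈ s, Tendsto (q i) atTop (𝓝 0) := by
    intro i hi
    have := (tendsto_exp_neg_mul (hρ i hi)).const_mul (Complex.exp (2 * Complex.I * θ i))
    rw [mul_zero] at this
    exact this.congr fun t => (hqe i t).symm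
  have hsin : ∀ᶠ t : ℝ in atTop, ∀ i ∈ s, Complex.sin (θ i + Complex.I * t * ρ i) ≠ 0 := by
    refine (Filter.eventually_all_finset s).2 fun i hi => ?_
    have : Tendsto (fun t : ℝ => (θ i + Complex.I * t * ρ i).im) atTop atTop := by
      simp only [him]
      exact tendsto_atTop_add_const_left _ _ (tendsto_id.atTop_mul_const (hρ i hi))
    filter_upwards [this.eventually_ne_atTop 0] with t ht
    exact sin_ne_zero_of_im_ne_zero ht
  -- The constant terms `-i w i` cancel by `hsum`. After scaling by `e^{2tρ₀}`, the terms with `ρ i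
  -- = ρ₀` survive and all others decay; `hρ₀` rules out purely oscillating ones.
  have hrel : ∀ᶠ t : ℝ in atTop,
      ∑ i ∈ s, w i * (q i t * Complex.exp (2 * t * ρ₀) / (1 - q i t)) = 0 := by
    filter_upwards [h, hsin] with t ht hs
    have h1 : ∑ i ∈ s, w i * Complex.cot (θ i + Complex.I * t * ρ i) =
        -Complex.I * ∑ i ∈ s, w i - 2 * Complex.I * ∑ i ∈ s, w i * (q i t / (1 - q i t)) := by
      rw [Finset.mul_sum, Finset.mul_sum, ← Finset.sum_sub_distrib]
      refine Finset.sum_congr rfl fun i hi => ?_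
      rw [cot_eq_neg_I_sub (hs i hi)]
      ring
    rw [h1, hsum, mul_zero, zero_sub, neg_eq_zero, mul_eq_zero,
      or_iff_right (mul_ne_zero two_ne_zero Complex.I_ne_zero)] at ht
    have h2 := congrArg (Complex.exp (2 * t * ρ₀) * ·) ht
    simp only [Finset.mul_sum, mul_zero] at h2
    rw [← h2]
    exact Finset.sum_congr rfl fun i _ => by ring
  have hlim : ∀ i ∈ s, Tendsto (fun t => w i * (q i t * Complex.exp (2 * t * ρ₀) / (1 - q i t)))
      atTop (𝓝 (if ρ i = ρ₀ then w i * Complex.exp (2 * Complex.I * θ i) else 0)) := by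
    intro i hi
    have h1 : ∀ t : ℝ, q i t * Complex.exp (2 * t * ρ₀) =
        Complex.exp (2 * Complex.I * θ i) * Complex.exp (-2 * t * (ρ i - ρ₀)) := by
      intro t
      rw [hqe, mul_assoc, ← Complex.exp_add]
      ring_nf
    have h2 := (hq0 i hi).const_sub 1
    rw [sub_zero] at h2
    split_ifs with hi0
    · have h3 := ((tendsto_const_nhds (x := Complex.exp (2 * Complex.I * θ i))).div h2
        one_ne_zero).const_mul (w i)
      rw [div_one] at h3
      refine h3.congr fun t => ?_
      simp [h1, hi0]
    · have hpos : 0 < (ρ i - ρ₀).re := by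
        simpa using (hρ₀ i hi).resolve_left hi0
      have h3 := (((tendsto_exp_neg_mul hpos).const_mul (Complex.exp (2 * Complex.I * θ i))).div h2
        one_ne_zero).const_mul (w i)
      rw [mul_zero, zero_div, mul_zero] at h3
      refine h3.congr fun t => ?_
      simp only [Pi.div_apply, h1]
  have h1 := tendsto_nhds_unique ((tendsto_finsetSum s hlim).congr' hrel) tendsto_const_nhds
  rw [Finset.sum_filter]
  exact h1

/-! ### Splitting a cotangent relation into `α`-series. -/

section

variable {V : Type*} [AddCommGroup V] [Module ℂ V]

lemma sgn_mul_self (r : ℝ) : sgn r * sgn r = 1 := by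
  rw [sgn]; split_ifs <;> norm_num

lemma sgn_neg {r : ℝ} (hr : r ≠ 0) : sgn (-r) = -sgn r := by
  rcases hr.lt_or_gt with h | h
  · simp [sgn, h, h.not_gt]
  · simp [sgn, h, h.not_gt]

lemma re_sgn_mul (z : ℂ) : (sgn z.re * z).re = |z.re| := by
  rw [sgn]
  split_ifs with h
  · simp [abs_of_pos h]
  · simp [abs_of_nonpos (not_lt.1 h)]

/-- Two covectors that agree up to sign modulo `α` agree modulo `α` after making them positive on
a vector `v` with `α(v) = 0`. -/
lemma makePos_eq_add {α β γ : Module.Dual ℂ V} {v : V} (hv : α v = 0) (hγ : (γ v).re ≠ 0) {k : ℂ}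
    (h : β = γ + k • α ∨ β = -γ + k • α) :
    sgn (β v).re • β = sgn (γ v).re • γ + (sgn (β v).re * k) • α := by
  rcases h with rfl | rfl
  · simp [hv]
    module
  · simp [hv, sgn_neg hγ]
    module

lemma makePos_eq_add_zsmul {α β γ : Module.Dual ℂ V} {v : V} (hv : α v = 0) (hγ : (γ v).re ≠ 0)
    (h : seriesSetoid α γ β) : ∃ m : ℤ, sgn (β v).re • β = sgn (γ v).re • γ + m • α := by
  obtain ⟨m, h⟩ := h
  simp only [← Int.cast_smul_eq_zsmul ℂ] at h ⊢
  rw [makePos_eq_add hv hγ h]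
  generalize sgn (γ v).re = ε
  rw [sgn]
  split_ifs
  · exact ⟨m, by simp⟩
  · exact ⟨-m, by simp⟩

lemma abs_re_eq_of_seriesSetoid {α β γ : Module.Dual ℂ V} {v : V} (hv : α v = 0)
    (h : seriesSetoid α γ β) : |(β v).re| = |(γ v).re| := by
  obtain ⟨m, rfl | rfl⟩ := h <;> simp [hv]

lemma seriesSetoid_of_makePos {α β γ : Module.Dual ℂ V} {v : V} {m : ℤ}
    (h : sgn (β v).re • β = sgn (γ v).re • γ + m • α) : seriesSetoid α γ β := by
  have hs : ∀ r, sgn r = 1 ∨ sgn r = -1 := fun r => by rw [sgn]; split_ifs <;> simp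
  rcases hs (β v).re with h1 | h1 <;> rcases hs (γ v).re with h2 | h2 <;>
    simp only [h1, h2, one_smul, neg_smul] at h
  · exact ⟨m, Or.inl h⟩
  · exact ⟨m, Or.inr h⟩
  · exact ⟨-m, Or.inr (by rw [neg_eq_iff_eq_neg] at h; rw [h]; module)⟩
  · exact ⟨-m, Or.inl (by rw [neg_eq_iff_eq_neg] at h; rw [h]; module)⟩

lemma sgn_mul_cot_eq {α β γ : Module.Dual ℂ V} {v x : V} (hv : α v = 0) (hγ : (γ v).re ≠ 0)
    (h : seriesSetoid α γ β) (hx : Complex.sin (α x) = 0) :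
    sgn (β v).re * Complex.cot (β x) = sgn (γ v).re * Complex.cot (γ x) := by
  obtain ⟨k, hk⟩ := Complex.sin_eq_zero_iff.1 hx
  have hm : ∀ (m : ℤ) (δ : Module.Dual ℂ V),
      Complex.cot ((δ + m • α) x) = Complex.cot (δ x) := by
    intro m δ
    rw [← cot_add_int_mul_pi (δ x) (m * k)]
    simp [hk, mul_assoc]
  obtain ⟨m, rfl | rfl⟩ := h
  · rw [hm]; simp [hv]
  · rw [hm]; simp [hv, sgn_neg hγ, cot_neg]

open Classical in
/-- A relation between cotangents on the hyperplanes `α ∈ ℤ π` splits into relations for the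
`α`-series. -/
lemma sum_series_eq_zero_of_cot {α : Module.Dual ℂ V} {v a : V} (hv : α v = 0) (ha : α a = 1)
    (d : Module.Dual ℂ V → ℂ) {T₀ : Finset (Module.Dual ℂ V)} (hre : ∀ β ∈ T₀, (β v).re ≠ 0)
    (hsep : ∀ β ∈ T₀, ∀ γ ∈ T₀, |(β v).re| = |(γ v).re| →
      ∃ k : ℂ, β = γ + k • α ∨ β = -γ + k • α)
    (T : Finset (Module.Dual ℂ V)) (hT : T ⊆ T₀)
    (hE : ∀ x, Complex.sin (α x) = 0 → (∀ β ∈ T₀, Complex.sin (β x) ≠ 0) →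
      ∑ β ∈ T, d β * β v ^ 2 * Complex.cot (β x) = 0) :
    ∀ β ∈ T, ∑ γ ∈ T with seriesSetoid α γ β, sgn (γ v).re * d γ = 0 := by
  -- Each round removes the covectors with the smallest `|Re β(v)|`, whose exponentials decay most
  -- slowly along `x + i t v`. The set `T₀`, which controls poles and separation, stays fixed.
  induction T using Finset.strongInduction with
  | H T ih =>
  intro β₁ hβ₁
  obtain ⟨β₀, hβ₀, hmin⟩ := T.exists_min_image (fun β => |(β v).re|) ⟨β₁, hβ₁⟩
  set ρ : Module.Dual ℂ V → ℂ := fun β => sgn (β v).re * β v with hρdef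
  set T₁ := T.filter fun β => ρ β = ρ β₀ with hT₁
  have hρre : ∀ β, (ρ β).re = |(β v).re| := fun β => re_sgn_mul _
  have hρeq : ∀ β ∈ T₀, ∀ γ ∈ T₀, |(β v).re| = |(γ v).re| → ρ β = ρ γ := by
    intro β hβ γ hγ h
    obtain ⟨k, hk⟩ := hsep β hβ γ hγ h
    have h2 := makePos_eq_add hv (hre γ hγ) hk
    have := congrArg (fun f : Module.Dual ℂ V => f v) h2
    simpa [hv] using this
  have hdiff : ∀ β ∈ T₀, ∀ γ ∈ T₀, ρ β = ρ γ →
      ∃ k : ℂ, sgn (β v).re • β = sgn (γ v).re • γ + k • α := by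
    intro β hβ γ hγ h
    obtain ⟨k, hk⟩ := hsep β hβ γ hγ (by rw [← hρre, h, hρre])
    have h2 := makePos_eq_add hv (hre γ hγ) hk
    exact ⟨_, h2⟩
  have hρne : ρ β₀ ≠ 0 := fun h => by
    have := hρre β₀
    rw [h, Complex.zero_re] at this
    exact hre β₀ (hT hβ₀) (abs_eq_zero.1 this.symm)
  -- Here `x` may be singular for `T₀`: the shift by `i t v` keeps `α(x)` and leaves all those poles
  -- for large `t`.
  have hlead : ∀ x, Complex.sin (α x) = 0 → ∑ β ∈ T₁,
      sgn (β v).re * d β * Complex.exp (2 * Complex.I * (sgn (β v).re * β x)) = 0 := by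
    intro x hx
    have h1 := sum_leading_eq_zero (s := T) (w := fun β => sgn (β v).re * (d β * β v ^ 2))
      (θ := fun β => sgn (β v).re * β x) (ρ := ρ) (ρ₀ := ρ β₀) ?_ ?_ ?_
    · have h2 : ∀ β ∈ T₁, sgn (β v).re * (d β * β v ^ 2) *
          Complex.exp (2 * Complex.I * (sgn (β v).re * β x)) = ρ β₀ ^ 2 * (sgn (β v).re * d β *
          Complex.exp (2 * Complex.I * (sgn (β v).re * β x))) := by
        intro β hβ
        rw [← (Finset.mem_filter.1 hβ).2]
        simp only [hρdef]
        linear_combination (-(sgn (β v).re * d β * β v ^ 2 *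
          Complex.exp (2 * Complex.I * (sgn (β v).re * β x)))) * sgn_mul_self (β v).re
      rw [Finset.sum_congr rfl h2, ← Finset.mul_sum] at h1
      exact (mul_eq_zero.1 h1).resolve_left (pow_ne_zero 2 hρne)
    · intro β hβ
      rw [hρre]
      exact abs_pos.2 (hre β (hT hβ))
    · intro β hβ
      rcases (hmin β hβ).eq_or_lt with h | h
      · exact Or.inl (hρeq _ (hT hβ) _ (hT hβ₀) h.symm)
      · right; rwa [hρre, hρre]
    · have hsin : ∀ᶠ t : ℝ in atTop, ∀ β ∈ T₀,
          Complex.sin (β (x + (Complex.I * t) • v)) ≠ 0 := by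
        refine (Filter.eventually_all_finset T₀).2 fun β hβ => ?_
        filter_upwards [eventually_ne_atTop (-(β x).im / (β v).re)] with t ht
        refine sin_ne_zero_of_im_ne_zero ?_
        rw [Ne, eq_div_iff (hre β hβ)] at ht
        contrapose! ht
        simp at ht
        linarith
      filter_upwards [hsin] with t ht
      rw [← hE (x + (Complex.I * t) • v) (by simpa [hv] using hx) ht]
      refine Finset.sum_congr rfl fun β _ => ?_
      have e : sgn (β v).re * β x + Complex.I * t * ρ β =
          sgn (β v).re * β (x + (Complex.I * t) • v) := by
        simp only [hρdef, map_add, map_smul, smul_eq_mul]; ring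
      rw [e]
      generalize β (x + (Complex.I * t) • v) = y
      rw [sgn]
      split_ifs
      · simp
      · simp [cot_neg]
  have hser : ∀ β ∈ T₁, ∑ γ ∈ T₁ with seriesSetoid α γ β, sgn (γ v).re * d γ = 0 := by
    intro β hβ
    -- At `x = kπa` the exponentials are `k`-th powers. The sign-normalised covectors of `T₁` differ
    -- by complex multiples of `α`, and two nodes agree exactly when the multiple is an integer, so
    -- the nodes label the series.
    have h1 := sum_filter_eq_zero_of_pow_sums (s := T₁) (g := fun γ => sgn (γ v).re * d γ)
      (μ := fun γ => Complex.exp (2 * Real.pi * Complex.I * (sgn (γ v).re * γ a))) (fun k => by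
        rw [← hlead ((k * Real.pi : ℂ) • a) (by simpa [ha] using Complex.sin_nat_mul_pi k)]
        refine Finset.sum_congr rfl fun γ _ => ?_
        rw [← Complex.exp_nat_mul]
        congr 2
        simp
        ring) β
    rw [← h1]
    refine Finset.sum_congr (Finset.filter_congr fun γ hγ => ?_) fun _ _ => rfl
    have hβT := hT (Finset.mem_filter.1 hβ).1
    have hγT := hT (Finset.mem_filter.1 hγ).1
    rw [Complex.exp_eq_exp_iff_exists_int]
    constructor
    · intro h
      obtain ⟨m, hm⟩ := makePos_eq_add_zsmul hv (hre β hβT) ((seriesSetoid α).symm h)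
      refine ⟨m, ?_⟩
      have := congrArg (fun f : Module.Dual ℂ V => f a) hm
      simp [ha] at this
      rw [this]
      ring
    · rintro ⟨m, hm⟩
      obtain ⟨k, hk⟩ := hdiff γ hγT β hβT
        ((Finset.mem_filter.1 hγ).2.trans (Finset.mem_filter.1 hβ).2.symm)
      have h2 := congrArg (fun f : Module.Dual ℂ V => f a) hk
      simp [ha] at h2
      have h3 : (2 * Real.pi * Complex.I : ℂ) * (k - m) = 0 := by
        rw [h2] at hm
        linear_combination hm
      have h4 : k = m := by
        have := (mul_eq_zero.1 h3).resolve_left Complex.two_pi_I_ne_zero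
        exact sub_eq_zero.1 this
      rw [h4, Int.cast_smul_eq_zsmul] at hk
      exact (seriesSetoid α).symm (seriesSetoid_of_makePos hk)
  have hclosed : ∀ β ∈ T, ∀ γ ∈ T, seriesSetoid α γ β → (γ ∈ T₁ ↔ β ∈ T₁) := by
    intro β hβ γ hγ h
    have : ρ β = ρ γ := hρeq β (hT hβ) γ (hT hγ) (abs_re_eq_of_seriesSetoid hv h)
    simp [hT₁, hβ, hγ, this]
  by_cases h₁ : β₁ ∈ T₁
  · rw [← hser β₁ h₁]
    refine Finset.sum_congr ?_ fun _ _ => rfl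
    ext γ
    simp only [Finset.mem_filter]
    refine ⟨fun h => ⟨?_, h.2⟩, fun h => ⟨?_, h.2⟩⟩
    · exact (hclosed β₁ hβ₁ γ h.1 h.2).2 h₁
    · exact (Finset.mem_filter.1 h.1).1
  · have h₂ : β₁ ∈ T \ T₁ := Finset.mem_sdiff.2 ⟨hβ₁, h₁⟩
    rw [← ih (T \ T₁) (Finset.sdiff_ssubset (Finset.filter_subset _ _)
      ⟨β₀, Finset.mem_filter.2 ⟨hβ₀, rfl⟩⟩) (Finset.sdiff_subset.trans hT) ?_ β₁ h₂]
    · refine Finset.sum_congr ?_ fun _ _ => rfl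
      ext γ
      simp only [Finset.mem_filter, Finset.mem_sdiff]
      refine ⟨fun h => ⟨⟨h.1, fun hγ => h₁ ?_⟩, h.2⟩, fun h => ⟨h.1.1, h.2⟩⟩
      exact (hclosed β₁ hβ₁ γ h.1 h.2).1 hγ
    · intro x hx hs
      -- On a series `sgn · cot` is constant, so `T₁` drops out of the relation.
      have h3 : ∑ β ∈ T₁, d β * β v ^ 2 * Complex.cot (β x) = 0 := by
        refine Finset.sum_cancels_of_partition_cancels (seriesSetoid α) fun β hβ => ?_
        have hβT := hT (Finset.mem_filter.1 hβ).1
        calc _ = ∑ γ ∈ T₁ with seriesSetoid α γ β, sgn (γ v).re * d γ *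
              (ρ β₀ ^ 2 * (sgn (β v).re * Complex.cot (β x))) := by
              refine Finset.sum_congr rfl fun γ hγ => ?_
              obtain ⟨hγ1, hγβ⟩ := Finset.mem_filter.1 hγ
              rw [sgn_mul_cot_eq hv (hre γ (hT (Finset.mem_filter.1 hγ1).1)) hγβ hx,
                ← (Finset.mem_filter.1 hγ1).2]
              simp only [hρdef]
              linear_combination (-(d γ * γ v ^ 2 * Complex.cot (γ x))) *
                (sgn (γ v).re * sgn (γ v).re + 1) * sgn_mul_self (γ v).re
          _ = 0 := by rw [← Finset.sum_mul, hser β hβ, zero_mul]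
      have h4 := hE x hx hs
      rw [← Finset.sum_sdiff (Finset.filter_subset _ _ : T₁ ⊆ T), h3, add_zero] at h4
      exact h4

end

/-! ### Residues of the WDVV equations and the `∨`-conditions. -/

section

variable {V : Type*} [AddCommGroup V] [Module ℂ V]

/-- A vector of `ker α` that separates covectors up to sign and multiples of `α`. -/
lemma exists_separating {α : Module.Dual ℂ V} {a : V} (ha : α a = 1)
    (T : Finset (Module.Dual ℂ V)) (hT : ∀ β ∈ T, ¬ ∃ k : ℂ, β = k • α) :
    ∃ v, α v = 0 ∧ (∀ β ∈ T, (β v).re ≠ 0) ∧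
      ∀ β ∈ T, ∀ γ ∈ T, |(β v).re| = |(γ v).re| → ∃ k : ℂ, β = γ + k • α ∨ β = -γ + k • α := by
  classical
  obtain ⟨S, hTS, hsub, hadd⟩ : ∃ S : Finset (Module.Dual ℂ V), T ⊆ S ∧
      (∀ β ∈ T, ∀ γ ∈ T, β - γ ∈ S) ∧ ∀ β ∈ T, ∀ γ ∈ T, β + γ ∈ S :=
    ⟨T ∪ (Finset.image₂ (fun β γ => β - γ) T T ∪ Finset.image₂ (fun β γ => β + γ) T T),
      Finset.subset_union_left,
      fun β hβ γ hγ => Finset.mem_union_right _ (Finset.mem_union_left _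
        (Finset.mem_image₂_of_mem hβ hγ)),
      fun β hβ γ hγ => Finset.mem_union_right _ (Finset.mem_union_right _
        (Finset.mem_image₂_of_mem hβ hγ))⟩
  let J := {f : S // ¬ ∃ k : ℂ, (f : Module.Dual ℂ V) = k • α}
  obtain ⟨v, hv⟩ := exists_forall_re_ne_zero
    (fun f : J => (f.1.1 : Module.Dual ℂ V).domRestrict (LinearMap.ker α)) fun f hf => by
      -- A covector that vanishes on `ker α` equals `f(a) α`.
      refine f.2 ⟨f.1.1 a, ?_⟩
      ext x
      have hx : x - α x • a ∈ LinearMap.ker α := by simp [ha]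
      have := LinearMap.congr_fun hf ⟨_, hx⟩
      simp [sub_eq_zero] at this
      simp [this, mul_comm]
  have hv' : ∀ f ∈ S, (¬ ∃ k : ℂ, f = k • α) → (f v).re ≠ 0 :=
    fun f hf hfk => hv ⟨⟨f, hf⟩, hfk⟩
  refine ⟨v, v.2, fun β hβ => hv' β (hTS hβ) (hT β hβ), ?_⟩
  intro β hβ γ hγ h
  rcases abs_eq_abs.1 h with h | h
  · by_contra! hne
    refine hv' (β - γ) (hsub β hβ γ hγ) ?_ (by simp [h])
    rintro ⟨k, hk⟩
    exact (hne k).1 (by rw [← hk]; abel)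
  · by_contra! hne
    refine hv' (β + γ) (hadd β hβ γ hγ) ?_ (by simp [h])
    rintro ⟨k, hk⟩
    exact (hne k).2 (by rw [← hk]; abel)

lemma collinearCoeff_smul {A : Finset (Module.Dual ℂ V)} {α γ : Module.Dual ℂ V}
    (h : γ ∈ collinearSet A α) : γ = collinearCoeff α γ • α :=
  Classical.epsilon_spec (p := fun k : ℂ => γ = k • α) (mem_collinearSet.1 h).2

variable [FiniteDimensional ℂ V]

/-- The vanishing of the residue of the WDVV equations at a hyperplane `α ∈ ℤ π`. -/
lemma sum_cot_eq_zero_of_wdvv {A : Finset (Module.Dual ℂ V)} {c : Module.Dual ℂ V → ℂ}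
    (hG : (formG A c).Nondegenerate) {lam : ℂ} (hl : lam ≠ 0) (h0 : (0 : Module.Dual ℂ V) ∉ A)
    (h : ∀ x, (∀ α ∈ A, Complex.sin (α x) ≠ 0) → ∀ z w : altSquare V,
        formG1 A c z w + lam ^ 2 / 4 * cotPair A (veeKernel hG z w) x = 0)
    {α : Module.Dual ℂ V} (hα : α ∈ A)
    (hC : ∀ δ ⊆ collinearSet A α, δ.Nonempty → collinearSum c δ α ≠ 0) {x : V}
    (hx : Complex.sin (α x) = 0) (hx' : ∀ β ∈ A, β ∉ collinearSet A α → Complex.sin (β x) ≠ 0)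
    (z w : altSquare V) :
    ∑ β ∈ A, c β * α (vee hG β) * (formB α β z * formB α β w) * Complex.cot (β x) = 0 := by
  classical
  obtain ⟨u, hu⟩ := exists_forall_re_ne_zero (fun γ : A => (γ : Module.Dual ℂ V))
    fun γ hγ => h0 (hγ ▸ γ.2)
  have hu' : ∀ γ ∈ A, γ u ≠ 0 := fun γ hγ h => hu ⟨γ, hγ⟩ (by simp [h])
  set κ := veeKernel hG (z : V ⊗[ℂ] V) w with hκ
  -- The covectors singular at `x` are collinear with `α`, but which ones they are depends on `x`;
  -- hence `hC` is required for arbitrary subsets.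
  set S := A.filter fun γ => Complex.sin (γ x) = 0 with hS
  have hSα : ∀ γ ∈ S, γ ∈ collinearSet A α := fun γ hγ => by
    by_contra hn
    exact hx' γ (Finset.mem_filter.1 hγ).1 hn (Finset.mem_filter.1 hγ).2
  have hSS : ∀ γ ∈ S, ∀ β ∈ S, κ γ β = 0 := by
    intro γ hγ β hβ
    rw [hκ, collinearCoeff_smul (hSα γ hγ), collinearCoeff_smul (hSα β hβ)]
    simp [veeKernel, formB_smul_right, formB_smul_left, formB_self]
  have hres := tendsto_mul_cotSum (s := A) (κ := κ) (veeKernel_comm hG _ _)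
    (a := fun γ => γ x) (n := fun γ => γ u) hu' (S := S) (fun γ => Finset.mem_filter) hSS
  have hl2 : lam ^ 2 / 4 ≠ 0 := div_ne_zero (pow_ne_zero _ hl) (by norm_num)
  have hconst : ∀ᶠ t in 𝓝[≠] (0 : ℂ),
      t * cotSum A κ (fun γ => γ x) (fun γ => γ u) t = t * (-formG1 A c z w / (lam ^ 2 / 4)) := by
    have : ∀ᶠ t in 𝓝[≠] (0 : ℂ), ∀ γ ∈ A, Complex.sin (γ x + t * γ u) ≠ 0 :=
      (Filter.eventually_all_finset A).2 fun γ hγ => eventually_sin_line_ne_zero _ (hu' γ hγ)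
    filter_upwards [this] with t ht
    have h1 := h (x + t • u) (fun γ hγ => by simpa using ht γ hγ) z w
    have h2 : cotPair A κ (x + t • u) = cotSum A κ (fun γ => γ x) (fun γ => γ u) t := by
      simp [cotPair, cotSum]
    rw [← h2]
    congr 1
    rw [eq_div_iff hl2]
    linear_combination h1
  have hlim0 : Tendsto (fun t : ℂ => t * (-formG1 A c z w / (lam ^ 2 / 4))) (𝓝[≠] 0) (𝓝 0) := by
    have : Continuous fun t : ℂ => t * (-formG1 A c z w / (lam ^ 2 / 4)) := by fun_prop
    simpa using (this.tendsto 0).mono_left (nhdsWithin_le_nhds (s := {0}ᶜ))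
  have hzero := tendsto_nhds_unique (hres.congr' hconst) hlim0
  have hv : ∀ (k : ℂ) (γ : Module.Dual ℂ V), vee hG (k • γ) = k • vee hG γ := fun k γ => by
    simp [vee]
  -- For `γ = kα` the kernel contributes `c_γ k³` and the residue of the cotangent `k⁻¹`, so the
  -- total residue is a multiple of `C_S^α = ∑ c_γ k_γ²`.
  have hterm : ∀ γ ∈ S, (γ u)⁻¹ * ∑ β ∈ A, κ γ β * Complex.cot (β x) =
      (c γ * collinearCoeff α γ ^ 2) * ((α u)⁻¹ * ∑ β ∈ A, c β * α (vee hG β) *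
        (formB α β z * formB α β w) * Complex.cot (β x)) := by
    intro γ hγ
    have hγα := collinearCoeff_smul (hSα γ hγ)
    have hγu := hu' γ (Finset.mem_filter.1 hγ).1
    have hαu := hu' α hα
    set k := collinearCoeff α γ
    have hk : k ≠ 0 := fun hk => hγu (by rw [hγα, hk]; simp)
    have e : ∀ β, κ γ β = c γ * k ^ 3 * (c β * α (vee hG β) * (formB α β z * formB α β w)) := by
      intro β
      have e1 : formG A c (vee hG γ) (vee hG β) = k * α (vee hG β) := by
        rw [formG_vee, hγα]; simp
      have e2 : formB γ β = k • formB α β := by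
        conv_lhs => rw [hγα]
        rw [formB_smul_left]
      rw [hκ, veeKernel, e1, e2]
      simp only [LinearMap.smul_apply, smul_eq_mul]
      ring
    have hγu' : γ u = k * α u := by
      conv_lhs => rw [hγα]
      simp
    simp only [e, hγu', mul_assoc, Finset.mul_sum]
    refine Finset.sum_congr rfl fun β _ => ?_
    field_simp
  rw [Finset.sum_congr rfl hterm, ← Finset.sum_mul] at hzero
  have hCS : collinearSum c S α ≠ 0 := hC S hSα ⟨α, Finset.mem_filter.2 ⟨hα, hx⟩⟩
  have h1 := (mul_eq_zero.1 hzero).resolve_left two_ne_zero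
  have h2 := (mul_eq_zero.1 h1).resolve_left hCS
  exact (mul_eq_zero.1 h2).resolve_left (inv_ne_zero (hu' α hα))

/-- Testing the residue on `z = w = a ∧ v` with `α(a) = 1` and `α(v) = 0` turns `B_{α,β}(z)
B_{α,β}(w)` into `4 β(v)²`, the shape required by `sum_series_eq_zero_of_cot`. The resulting scalar
relation suffices, because `α ∧ γ = ± α ∧ β` within a series, with the sign recorded by `sgn`. -/
lemma isTrigVeeSystem_of_wdvv {A : Finset (Module.Dual ℂ V)} {c : Module.Dual ℂ V → ℂ}
    (hG : (formG A c).Nondegenerate) {lam : ℂ} (hl : lam ≠ 0) (h0 : (0 : Module.Dual ℂ V) ∉ A)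
    (hC : ∀ α ∈ A, ∀ δ ⊆ collinearSet A α, δ.Nonempty →
      ∀ α₀ ∈ collinearSet A α, collinearSum c δ α₀ ≠ 0)
    (h : ∀ x, (∀ α ∈ A, Complex.sin (α x) ≠ 0) → ∀ z w : altSquare V,
        formG1 A c z w + lam ^ 2 / 4 * cotPair A (veeKernel hG z w) x = 0) :
    IsTrigVeeSystem hG := by
  classical
  intro α hα Γ hΓ
  obtain ⟨a, ha⟩ : ∃ a, α a = 1 := by
    have hne : α ≠ 0 := fun h => h0 (h ▸ hα)
    obtain ⟨x, hx⟩ := DFunLike.ne_iff.1 hne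
    refine ⟨(α x)⁻¹ • x, ?_⟩
    have : α x ≠ 0 := by simpa using hx
    simp [this]
  set T := A.filter fun β => β ∉ collinearSet A α with hTdef
  have hTk : ∀ β ∈ T, ¬ ∃ k : ℂ, β = k • α := fun β hβ hk =>
    (Finset.mem_filter.1 hβ).2 (mem_collinearSet.2 ⟨(Finset.mem_filter.1 hβ).1, hk⟩)
  obtain ⟨v, hv, hre, hsep⟩ := exists_separating ha T hTk
  obtain ⟨β, hβ⟩ := hΓ.nonempty
  have hβT : β ∈ T := Finset.mem_filter.2 ⟨hΓ.subset hβ, hΓ.not_collinear β hβ⟩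
  have hΓeq : Γ = T.filter fun γ => seriesSetoid α γ β := by
    ext γ
    rw [Finset.mem_filter]
    constructor
    · intro hγ
      refine ⟨Finset.mem_filter.2 ⟨hΓ.subset hγ, hΓ.not_collinear γ hγ⟩, ?_⟩
      obtain ⟨m, hm⟩ := hΓ.related β hβ γ hγ
      refine ⟨m, ?_⟩
      rcases hm with hm | hm
      · exact Or.inr (by rw [← hm]; abel)
      · exact Or.inl (by rw [← hm]; abel)
    · rintro ⟨hγ, hs⟩
      obtain ⟨m, hm⟩ := (seriesSetoid α).symm hs
      exact hΓ.maximal β hβ γ (Finset.mem_filter.1 hγ).1 m hm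
  have key := sum_series_eq_zero_of_cot hv ha (fun γ => c γ * α (vee hG γ)) hre hsep T
    (Finset.Subset.refl T) (fun x hx hx' => ?_) β hβT
  · have hterm : ∀ γ ∈ Γ, (c γ * α (vee hG γ)) • wedge α γ =
        (sgn (γ v).re * (c γ * α (vee hG γ))) • (sgn (β v).re • wedge α β) := by
      intro γ hγ
      rw [hΓeq, Finset.mem_filter] at hγ
      obtain ⟨m, hm⟩ := makePos_eq_add_zsmul hv (hre β hβT) ((seriesSetoid α).symm hγ.2)
      have hγ' : γ = sgn (γ v).re • (sgn (β v).re • β + (m : ℂ) • α) := by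
        rw [Int.cast_smul_eq_zsmul, ← hm, smul_smul, sgn_mul_self, one_smul]
      have hw : wedge α γ = sgn (γ v).re • sgn (β v).re • wedge α β := by
        conv_lhs => rw [hγ']
        simp only [wedge, TensorProduct.tmul_smul, ← TensorProduct.smul_tmul',
          TensorProduct.tmul_add, TensorProduct.add_tmul]
        module
      rw [hw]
      module
    rw [Finset.sum_congr rfl hterm, ← Finset.sum_smul, hΓeq]
    convert zero_smul ℂ _ using 2
  · have h1 := sum_cot_eq_zero_of_wdvv hG hl h0 h hα
      (fun δ hδ hne => hC α hα δ hδ hne α (mem_collinearSet.2 ⟨hα, 1, by simp⟩)) hx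
      (fun β hβ hn => hx' β (Finset.mem_filter.2 ⟨hβ, hn⟩))
      ⟨wedge a v, wedge_mem_altSquare a v⟩ ⟨wedge a v, wedge_mem_altSquare a v⟩
    simp only [formB_wedge, ha, hv, zero_mul, one_mul, sub_zero] at h1
    rw [← Finset.sum_filter_add_sum_filter_not A (fun β => β ∉ collinearSet A α),
      Finset.sum_eq_zero (s := A.filter fun β => ¬ β ∉ collinearSet A α) fun β hβ => by
        obtain ⟨k, rfl⟩ := (mem_collinearSet.1 (not_not.1 (Finset.mem_filter.1 hβ).2)).2
        simp [hv], add_zero] at h1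
    have h2 : (4 : ℂ) * ∑ β ∈ T, c β * α (vee hG β) * β v ^ 2 * Complex.cot (β x) = 0 := by
      rw [← h1, Finset.mul_sum]
      exact Finset.sum_congr rfl fun β _ => by ring
    exact (mul_eq_zero.1 h2).resolve_left (by norm_num)

end

end TrigVee

end

theorem mainTheorem3 {V : Type*} [AddCommGroup V] [Module ℂ V] [FiniteDimensional ℂ V]
    {N : ℕ} (b : Module.Basis (Fin N) ℂ V)
    (A : Finset (Module.Dual ℂ V)) (c : Module.Dual ℂ V → ℂ) (lam : ℂ) (hlam : lam ≠ 0)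
    (h0 : (0 : Module.Dual ℂ V) ∉ A) (hA : TrigVee.InLattice A)
    (hG : (TrigVee.formG A c).Nondegenerate) :
    ((∀ α ∈ A, ∀ δ ⊆ TrigVee.collinearSet A α, δ.Nonempty →
          ∀ α₀ ∈ TrigVee.collinearSet A α, TrigVee.collinearSum c δ α₀ ≠ 0) →
        TrigVee.WDVVOn b (TrigVee.prepotential A c lam) (TrigVee.holDomain A) →
        TrigVee.IsTrigVeeSystem hG ∧
          ∀ v : V, TrigVee.IsRegular A v →
            TrigVee.formG1 A c = (lam ^ 2 / 4) • TrigVee.formG2 hG v) ∧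
      (TrigVee.IsTrigVeeSystem hG →
        (∃ v : V, TrigVee.IsRegular A v ∧
          TrigVee.formG1 A c = (lam ^ 2 / 4) • TrigVee.formG2 hG v) →
        TrigVee.WDVVOn b (TrigVee.prepotential A c lam) (TrigVee.holDomain A)) := by
  rw [TrigVee.wdvvOn_iff_cotPair b hG hlam h0]
  refine ⟨fun hC h => ⟨TrigVee.isTrigVeeSystem_of_wdvv hG hlam h0 hC h,
    fun v hv => TrigVee.formG1_eq_of_wdvv hG lam h hv⟩, ?_⟩
  rintro hvee ⟨v, hv, hG12⟩ x hx z w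
  rw [TrigVee.cotPair_eq_of_isTrigVeeSystem hA hvee hv z w hx, hG12]
  simp
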